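/- **Setting.** Let $V$ be a separable real Banach space, $(T_r)_{r\ge1}$ natural numbers and $I_r=\{0,\dots,T_r\}$. *Tensor algebras.* Fix an admissible choice of tensor norms: for every real normed space $E$ and $m\ge0$ a norm on $E^{\otimes m}$ such that $\|v\otimes w\|\le\|v\|\,\|w\|$ for all $v\in E^{\otimes m},w\in E^{\otimes n}$, $\|v_1\otimes\cdots\otimes v_m\|\le\prod_i\|v_i\|$, and $|(\ell_1\otimes\cdots\otimes\ell_m)(v)|\le\prod_i\|\ell_i\|\,\|v\|$ for all bounded linear functionals $\ell_i$ on $E$ (for instance the projective or the injective norms). For a normed space $E$, give $\mathbb R\oplus E$ the norm $|a|+\|v\|$ and let $\mathbf T(E)$ be the completion of $\bigoplus_{m\ge0}(\mathbb R\oplus E)^{\otimes m}$ for $\|t\|=\sum_m\|t_m\|$. Put $\mathrm{Ta}_0(V)=V$ and $\mathrm{Ta}_{r+1}(V)=\mathbf T(\mathrm{Ta}_r(V))$. *Signature.* For $x:\{0,\dots,T\}\to E$ let $\Delta_0x=(1,x(0))$, $\Delta_tx=(1,x(t)-x(t-1))$ for $t\ge1$, $\exp v=(v^{\otimes m}/m!)_{m\ge0}$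 and $S(x)=\exp(\Delta_0x)\exp(\Delta_1x)\cdots\exp(\Delta_Tx)\in\mathbf T(E)$. *Tensor normalization.* A tensor normalization on $\mathbf T(E)$ is a map $\Lambda$ that on $\{t:t_0=1\}$ is continuous, injective and bounded, and has the form $\Lambda(t)=(\lambda(t)^mt_m)_{m\ge0}$ with a function $\lambda>0$. *Paths and measures of higher rank.* Put $V_0=\mathrm{Prob}_0(V)=\mathcal M_0(V)=V$ and, for $r\ge1$, $V_r=(I_r\to V_{r-1})$ with the product topology; $\mathrm{Prob}_r(V)$, the Borel probability measures on $I_r\to\mathrm{Prob}_{r-1}(V)$ with the topology of weak convergence; $\mathcal M_r(V)$, the finite signed measures on $I_r\to\mathcal M_{r-1}(V)$, where $V$ carries its Borel $\sigma$-algebra, the spaces of paths the product $\sigma$-algebras, and $\mathcal M_r(V)$ the $\sigma$-algebra generated by the evaluations $\mu\mapsto\mu(A)$, $A$ measurable. *Robust maps.* Given a tensor normalization $\Lambda_{r}$ on $\mathbf T(\mathrm{Ta}_{r-1}(V))=\mathrm{Ta}_r(V)$ for every $r\ge1$, let $\mathrm S_0$ and $\bar{\mathrm S}_0$ be the identity of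 $V$ and, for $r\ge1$, $$\mathrm S_r(x)=\Lambda_r S\big(t\mapsto\mathrm S_{r-1}(x(t))\big),\quad x\in V_r,\qquad \bar{\mathrm S}_r(\mu)=\int\Lambda_r S\big(t\mapsto\bar{\mathrm S}_{r-1}(x(t))\big)\,\mu(dx),$$ for $\mu\in\mathrm{Prob}_r(V)$ and likewise for $\mu\in\mathcal M_r(V)$. **Proposition.** Every $\mathrm{Ta}_r(V)$, $r\ge0$, is a separable Banach space. Families $(\Lambda_r)_{r\ge1}$ of tensor normalizations as above exist. For every such family and every $r\ge1$: 1. the robust signature map $\mathrm S_r:V_r\to\mathrm{Ta}_r(V)$ is bounded, continuous and injective; 2. the integrand in the definition of $\bar{\mathrm S}_r$ is Bochner integrable with respect to every $\mu\in\mathrm{Prob}_r(V)$, and the robust expected signature map $\bar{\mathrm S}_r:\mathrm{Prob}_r(V)\to\mathrm{Ta}_r(V)$ is bounded, continuous and injective; 3. the integrand is also Bochner integrable with respect to (the total variation of) every $\mu\in\mathcal M_r(V)$, the map $\bar{\mathrm S}_r:\mathcal M_r(V)\to\mathrm{Ta}_r(V)$ is injective, and there is a constant $C$ with $\|\bar{\mathrm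 S}_r(\mu)\|\le C\,|\mu|\big(I_r\to\mathcal M_{r-1}(V)\big)$ for all $\mu\in\mathcal M_r(V)$. For $r=0$, where all the spaces are $V$, there is a bounded, continuous and injective map $V\to V$. -/

import Mathlib

universe u v

namespace HRSig

open MeasureTheory PiTensorProduct
open scoped TensorProduct

noncomputable section

/-- An admissible choice of norms on tensor powers: for every real normed space `E` and `m : ℕ`,
a norm on `E ^ ⊗ m` with `‖v ⊗ w‖ ≤ ‖v‖ ‖w‖` for arbitrary tensors, which is a reasonable
cross norm (elementary tensors and products of bounded functionals have norm at most the product of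
the norms).  By Hahn-Banach the last two fields give `‖v₁ ⊗ ⋯ ⊗ vₘ‖ = ‖v₁‖ ⋯ ‖vₘ‖`;
in particular the norm is invariant under permutations of the factors of an elementary tensor, it is
the given norm for `m = 1`, the absolute value for `m = 0`, and it is definite. The projective and
the injective norm are examples. -/
structure AdmissibleNorm : Type (u + 1) where
  seminorm : ∀ (E : Type u) [NormedAddCommGroup E] [NormedSpace ℝ E] (m : ℕ),
    Seminorm ℝ (⨂[ℝ]^m E)
  mul_le : ∀ (E : Type u) [NormedAddCommGroup E] [NormedSpace ℝ E] (m n : ℕ)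
    (v : ⨂[ℝ]^m E) (w : ⨂[ℝ]^n E),
    seminorm E (m + n) (GradedMonoid.GMul.mul (A := fun i => ⨂[ℝ]^i E) v w) ≤
      seminorm E m v * seminorm E n w
  tprod_le : ∀ (E : Type u) [NormedAddCommGroup E] [NormedSpace ℝ E] (m : ℕ) (v : Fin m → E),
    seminorm E m (tprod ℝ v) ≤ ∏ i, ‖v i‖
  dual_le : ∀ (E : Type u) [NormedAddCommGroup E] [NormedSpace ℝ E] (m : ℕ)
    (l : Fin m → (E →L[ℝ] ℝ)) (v : ⨂[ℝ]^m E),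
    |lift ((MultilinearMap.mkPiAlgebra ℝ (Fin m) ℝ).compLinearMap
        (fun i => (l i).toLinearMap)) v| ≤ (∏ i, ‖l i‖) * seminorm E m v

section Projective

theorem projective_mul_le_aux (E : Type u) [NormedAddCommGroup E] [NormedSpace ℝ E] (m n : ℕ)
    (v : Fin m → E) (w : Fin n → E) :
   ‖(GradedMonoid.GMul.mul (A := fun i => ⨂[ℝ]^i E) (tprod ℝ v) (tprod ℝ w))‖ ≤ (∏ i, ‖v i‖) * ∏ i, ‖w i‖ := by
  rw [TensorPower.tprod_mul_tprod]
  refine (projectiveSeminorm_tprod_le _).trans (le_of_eq ?_)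
  rw [Fin.prod_univ_add]; simp

theorem projective_bound_aux (E : Type u) [NormedAddCommGroup E] [NormedSpace ℝ E] {m : ℕ}
    {G : Type v} [SeminormedAddCommGroup G] [NormedSpace ℝ G] (f : (⨂[ℝ]^m E) →ₗ[ℝ] G) (C : ℝ)
    (hC : 0 ≤ C) (h : ∀ v, ‖f (tprod ℝ v)‖ ≤ C * ∏ i, ‖v i‖) (x) : ‖f x‖ ≤ C * ‖x‖ := by
  let g := (f.compMultilinearMap (tprod ℝ)).mkContinuous C h
  have h1 := norm_eval_le_projectiveSeminorm (f := g) x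
  have : lift g.toMultilinearMap = f := by
    ext v; simp only [LinearMap.compMultilinearMap_apply, lift.tprod]; rfl
  rw [this] at h1
  exact h1.trans (mul_le_mul_of_nonneg_right (MultilinearMap.mkContinuous_norm_le _ hC _) (norm_nonneg _))

/-- The projective tensor norm is admissible. -/
def projectiveNorm : AdmissibleNorm.{u} where
  seminorm E _ _ m := projectiveSeminorm
  mul_le E _ _ m n v w := by
    rw [mul_comm]
    let B : (⨂[ℝ]^m E) →ₗ[ℝ] (⨂[ℝ]^n E) →ₗ[ℝ] (⨂[ℝ]^(m + n) E) :=
      ((TensorProduct.mk ℝ _ _).compr₂ ↑(TensorPower.mulEquiv : _ ≃ₗ[ℝ] (⨂[ℝ]^(m + n)) E))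
    refine projective_bound_aux E (B.flip w) ‖w‖ (norm_nonneg _) (fun v => ?_) v
    rw [mul_comm]
    refine projective_bound_aux E (B (tprod ℝ v)) _ (by positivity) (fun w => ?_) w
    exact projective_mul_le_aux E m n v w
  tprod_le E _ _ m v := projectiveSeminorm_tprod_le v
  dual_le E _ _ m l v := by
    refine projective_bound_aux E (lift ((MultilinearMap.mkPiAlgebra ℝ (Fin m) ℝ).compLinearMap
        (fun i => (l i).toLinearMap))) _ (by positivity) (fun v => ?_) v
    simp only [lift.tprod, MultilinearMap.compLinearMap_apply, MultilinearMap.mkPiAlgebra_apply]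
    rw [norm_prod, ← Finset.prod_mul_distrib]
    exact Finset.prod_le_prod (fun _ _ => norm_nonneg _) (fun i _ => (l i).le_opNorm _)

end Projective

/-- The algebraic tensor power `E ^ ⊗ m` with the chosen norm. -/
def TPow (_α : AdmissibleNorm.{u}) (E : Type u) [NormedAddCommGroup E] [NormedSpace ℝ E]
    (m : ℕ) : Type u := ⨂[ℝ]^m E

section TA

variable (α : AdmissibleNorm.{u}) (E : Type u) [NormedAddCommGroup E] [NormedSpace ℝ E]

instance (m : ℕ) : SeminormedAddCommGroup (TPow α E m) :=
  @AddGroupSeminorm.toSeminormedAddCommGroup (⨂[ℝ]^m E) _ (α.seminorm E m).toAddGroupSeminorm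

instance (m : ℕ) : NormedSpace ℝ (TPow α E m) where
  toModule := inferInstanceAs (Module ℝ (⨂[ℝ]^m E))
  norm_smul_le a b := (map_smul_eq_mul (α.seminorm E m) a b).le

/-- The inclusion of the algebraic tensor power into its completion. -/
def toCompletion (m : ℕ) (a : ⨂[ℝ]^m E) : UniformSpace.Completion (TPow α E m) :=
  UniformSpace.Completion.coe' (α := TPow α E m) a

theorem norm_toCompletion (m : ℕ) (a : ⨂[ℝ]^m E) :
    ‖toCompletion α E m a‖ = α.seminorm E m a :=
  UniformSpace.Completion.norm_coe (E := TPow α E m) a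

/-- `ℝ ⊕ E`, the first coordinate being time, with the norm `|a| + ‖v‖`. -/
abbrev TimeExt : Type u := WithLp 1 (ℝ × E)

/-- The tensor algebra over `ℝ ⊕ E`, completed for the norm `‖t‖ = ∑ₘ ‖tₘ‖`: sequences `(tₘ)` with
`tₘ` in the completion of `(ℝ ⊕ E) ^ ⊗ m` and `∑ₘ ‖tₘ‖ < ∞`. This is the completion of
`⨁ₘ (ℝ ⊕ E) ^ ⊗ m`, which sits in it as a dense subspace. -/
abbrev TA : Type u := lp (fun m : ℕ => UniformSpace.Completion (TPow α (TimeExt E) m)) 1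

end TA

section Series

variable {E : Type u} [NormedAddCommGroup E] [NormedSpace ℝ E]

/-- The unit `(1, 0, 0, …)` of `∏ₘ E ^ ⊗ m`. -/
def tone : ∀ m : ℕ, ⨂[ℝ]^m E
  | 0 => tprod ℝ (fun _ => 0)
  | _ + 1 => 0

/-- The tensor convolution product on `∏ₘ E ^ ⊗ m`, `(s t)ₘ = ∑_{i ≤ m} sᵢ ⊗ tₘ₋ᵢ`. -/
def tconv (s t : ∀ m : ℕ, ⨂[ℝ]^m E) (m : ℕ) : ⨂[ℝ]^m E :=
  ∑ i : Fin (m + 1), TensorPower.cast ℝ E (Nat.add_sub_cancel' (Nat.lt_succ_iff.mp i.2))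
    (GradedMonoid.GMul.mul (A := fun i => ⨂[ℝ]^i E) (s i) (t (m - i)))

/-- The tensor exponential `v ↦ (v ^ ⊗ m / m!)ₘ`. -/
def texp (v : E) (m : ℕ) : ⨂[ℝ]^m E := ((m.factorial : ℝ)⁻¹) • tprod ℝ (fun _ : Fin m => v)

/-- The time-extended increments of a path indexed by `{0, …, T}`:
`Δ₀ x = (1, x 0)` and `Δₜ x = (1, x t - x (t - 1))` for `t ≥ 1`. -/
def incr {T : ℕ} (x : Fin (T + 1) → E) : Fin (T + 1) → TimeExt E :=
  Fin.cases (WithLp.toLp 1 (1, x 0)) (fun t : Fin T => WithLp.toLp 1 (1, x t.succ - x t.castSucc))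

/-- The signature as an element of `∏ₘ (ℝ ⊕ E) ^ ⊗ m`: the ordered product
`exp (Δ₀ x) · exp (Δ₁ x) ⋯ exp (Δ_T x)`. -/
def sigSeries {T : ℕ} (x : Fin (T + 1) → E) : ∀ m : ℕ, ⨂[ℝ]^m (TimeExt E) :=
  (List.ofFn (incr x)).foldr (fun v s => tconv (texp v) s) tone

variable (α : AdmissibleNorm.{u})

/-- The series converges absolutely. -/
def AbsSummable (s : ∀ m : ℕ, ⨂[ℝ]^m E) : Prop := Summable fun m => α.seminorm E m (s m)


end Series
section Summability

theorem seminorm_cast {E : Type u} [NormedAddCommGroup E] [NormedSpace ℝ E]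
    (α : AdmissibleNorm.{u}) {i j : ℕ} (h : i = j) (a : ⨂[ℝ]^i E) :
    α.seminorm E j (TensorPower.cast ℝ E h a) = α.seminorm E i a := by
  subst h
  simp [TensorPower.cast_refl]

theorem AbsSummable.tconv {E : Type u} [NormedAddCommGroup E] [NormedSpace ℝ E]
    {α : AdmissibleNorm.{u}} {s t : ∀ m : ℕ, ⨂[ℝ]^m E}
    (hs : AbsSummable α s) (ht : AbsSummable α t) : AbsSummable α (tconv s t) := by
  have h := summable_norm_sum_mul_range_of_summable_norm
    (f := fun m => α.seminorm E m (s m)) (g := fun m => α.seminorm E m (t m)) hs.norm ht.norm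
  refine Summable.of_nonneg_of_le (fun m => apply_nonneg _ _) (fun m => ?_) h
  refine le_trans ?_ (le_abs_self _)
  rw [Finset.sum_range]
  refine (Finset.le_sum_of_subadditive (α.seminorm E m) (map_zero (α.seminorm E m)).le
    (map_add_le_add _) _ _).trans (Finset.sum_le_sum fun i _ => ?_)
  rw [seminorm_cast]
  exact α.mul_le E _ _ _ _

theorem AbsSummable.tone {E : Type u} [NormedAddCommGroup E] [NormedSpace ℝ E]
    (α : AdmissibleNorm.{u}) : AbsSummable α (tone (E := E)) := by
  refine summable_of_ne_finset_zero (s := {0}) (fun m hm => ?_)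
  cases m with
  | zero => simp at hm
  | succ n => exact map_zero (α.seminorm E (n + 1))

theorem AbsSummable.texp {E : Type u} [NormedAddCommGroup E] [NormedSpace ℝ E]
    (α : AdmissibleNorm.{u}) (v : E) : AbsSummable α (texp v) := by
  refine Summable.of_nonneg_of_le (fun m => apply_nonneg _ _) (fun m => ?_)
    (Real.summable_pow_div_factorial ‖v‖)
  have h := α.tprod_le E m (fun _ => v)
  rw [Finset.prod_const, Finset.card_fin] at h
  have h2 : α.seminorm E m (HRSig.texp v m) =
      (m.factorial : ℝ)⁻¹ * α.seminorm E m (tprod ℝ (fun _ : Fin m => v)) := by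
    rw [HRSig.texp, map_smul_eq_mul, Real.norm_of_nonneg (by positivity)]
  rw [h2, div_eq_inv_mul]
  exact mul_le_mul_of_nonneg_left h (by positivity)

theorem absSummable_sigSeries {E : Type u} [NormedAddCommGroup E] [NormedSpace ℝ E]
    (α : AdmissibleNorm.{u}) {T : ℕ} (x : Fin (T + 1) → E) : AbsSummable α (sigSeries x) := by
  unfold sigSeries
  induction List.ofFn (incr x) with
  | nil => exact AbsSummable.tone α
  | cons v l ih => exact (AbsSummable.texp α v).tconv ih

end Summability

section Signature

variable (α : AdmissibleNorm.{u}) {E : Type u} [NormedAddCommGroup E] [NormedSpace ℝ E]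

/-- The (rank one) signature `(I → E) → T(ℝ ⊕ E)` of a path indexed by `I = {0, …, T}`. -/
def sig {T : ℕ} (x : Fin (T + 1) → E) : TA α E :=
  ⟨fun m => toCompletion α _ m (sigSeries x m), by
    refine memℓp_gen ?_
    simp only [norm_toCompletion, ENNReal.toReal_one, Real.rpow_one]
    exact absSummable_sigSeries α x⟩

/-- The elements `t` of the tensor algebra with `t₀ = 1`. -/
def unitLevel (E : Type u) [NormedAddCommGroup E] [NormedSpace ℝ E] : Set (TA α E) :=
  {t | t 0 = toCompletion α _ 0 (tone 0)}

/-- `Λ` is a tensor normalization: on `{t | t₀ = 1}` it is a continuous injective map with values in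
a ball, of the form `t ↦ δ_{λ(t)} t = (λ(t) ^ m tₘ)ₘ` with a function `λ > 0`.
(Its values elsewhere are irrelevant.) -/
def IsTensorNormalization (Λ : TA α E → TA α E) : Prop :=
  (∃ lam : TA α E → ℝ, ∀ t ∈ unitLevel α E, 0 < lam t ∧ ∀ m : ℕ, Λ t m = lam t ^ m • t m) ∧
  (∃ K : ℝ, ∀ t ∈ unitLevel α E, ‖Λ t‖ ≤ K) ∧
  ContinuousOn Λ (unitLevel α E) ∧
  Set.InjOn Λ (unitLevel α E)

end Signature

/-- A bundled real normed space, used to iterate the tensor algebra construction. -/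
structure NormedSp : Type (u + 1) where
  carrier : Type u
  [group : NormedAddCommGroup carrier]
  [space : NormedSpace ℝ carrier]

attribute [instance] NormedSp.group NormedSp.space

/-- `T₀(V) = V` and `Tᵣ₊₁(V) = T(ℝ ⊕ Tᵣ(V))`. -/
def taTower (α : AdmissibleNorm.{u}) (V : Type u) [NormedAddCommGroup V] [NormedSpace ℝ V] :
    ℕ → NormedSp.{u}
  | 0 => ⟨V⟩
  | r + 1 => ⟨TA α (taTower α V r).carrier⟩

/-- The rank `r` tensor algebra of `V`. -/
abbrev Ta (α : AdmissibleNorm.{u}) (V : Type u) [NormedAddCommGroup V] [NormedSpace ℝ V] (r : ℕ) :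
    Type u := (taTower α V r).carrier

section Domains

variable (T : ℕ → ℕ)

/-- Paths of rank `r` with values in `V`; the `(r + 1)`-st time set is `{0, …, T r}`. -/
def PathSp (V : Type u) : ℕ → Type u
  | 0 => V
  | r + 1 => Fin (T r + 1) → PathSp V r

instance pathSpTopology (V : Type u) [TopologicalSpace V] :
    ∀ r, TopologicalSpace (PathSp T V r)
  | 0 => inferInstanceAs (TopologicalSpace V)
  | r + 1 =>
    letI := pathSpTopology V r
    inferInstanceAs (TopologicalSpace (Fin (T r + 1) → PathSp T V r))

/-- Borel probability measures on a topological space. -/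
def BorelProb (X : Type u) [TopologicalSpace X] : Type u := @ProbabilityMeasure X (borel X)

/-- The underlying Borel measure. -/
def BorelProb.toMeasure {X : Type u} [TopologicalSpace X] (μ : BorelProb X) :
    @Measure X (borel X) := μ.1

/-- The topology of weak convergence. -/
instance (X : Type u) [TopologicalSpace X] : TopologicalSpace (BorelProb X) :=
  @ProbabilityMeasure.instTopologicalSpace X (borel X) _
    (@BorelSpace.opensMeasurable X _ (borel X) (@BorelSpace.mk X _ (borel X) rfl))

/-- `Prob₀(V) = V` and `Probᵣ₊₁(V) = Prob(I → Probᵣ(V))`, with the weak topologies. -/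
def probTower (V : Type u) [TopologicalSpace V] : ℕ → TopCat.{u}
  | 0 => TopCat.of V
  | r + 1 => TopCat.of (BorelProb (Fin (T r + 1) → probTower V r))

/-- Rank `r` probability measures on `V`. -/
abbrev ProbSp (V : Type u) [TopologicalSpace V] (r : ℕ) : Type u := (probTower T V r : Type u)

/-- The `σ`-algebra on the space of finite signed measures that is generated by the evaluations
`μ ↦ μ(A)`, `A` measurable. -/
instance signedMeasurableSpace (X : Type u) [MeasurableSpace X] :
    MeasurableSpace (SignedMeasure X) :=
  ⨆ (A : Set X) (_ : MeasurableSet A), (borel ℝ).comap fun μ : SignedMeasure X => μ A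

/-- `M₀(V) = V` and `Mᵣ₊₁(V) = M(I → Mᵣ(V))`, where `M` denotes finite signed measures. -/
def measTower (V : Type u) [TopologicalSpace V] : ℕ → MeasCat.{u}
  | 0 => @MeasCat.of V (borel V)
  | r + 1 => MeasCat.of (SignedMeasure (Fin (T r + 1) → measTower V r))

/-- Rank `r` (finite signed) measures on `V`. -/
abbrev MeasSp (V : Type u) [TopologicalSpace V] (r : ℕ) : Type u := (measTower T V r : Type u)

end Domains

/-- The Bochner integral with respect to a finite signed measure, `∫ f dμ⁺ - ∫ f dμ⁻`. -/
def signedIntegral {X : Type u} [MeasurableSpace X] {F : Type v} [NormedAddCommGroup F]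
    [NormedSpace ℝ F] (μ : SignedMeasure X) (f : X → F) : F :=
  ∫ x, f x ∂μ.toJordanDecomposition.posPart - ∫ x, f x ∂μ.toJordanDecomposition.negPart

section Robust

variable {α : AdmissibleNorm.{u}} {V : Type u} [NormedAddCommGroup V] [NormedSpace ℝ V]
variable (Λ : ∀ r, TA α (Ta α V r) → TA α (Ta α V r)) (T : ℕ → ℕ)

/-- The robust signature `x ↦ Λ(S(g ∘ x))` of a path that is first mapped to `Tᵣ(V)` by `g`. -/
def liftSig {X : Type u} {r n : ℕ} (g : X → Ta α V r) (x : Fin (n + 1) → X) : Ta α V (r + 1) :=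
  Λ r (sig α (fun t => g (x t)))

/-- The robust signature map of rank `r`, which is the identity for `r = 0`. -/
def robustSig : ∀ r, PathSp T V r → Ta α V r
  | 0 => fun x => x
  | r + 1 => fun x => liftSig Λ (robustSig r) x

/-- The robust expected signature map of rank `r` on rank `r` probability measures, which is the
identity for `r = 0`. -/
def robustESig : ∀ r, ProbSp T V r → Ta α V r
  | 0 => fun x => x
  | r + 1 => fun μ =>
    @integral _ _ _ _ (borel _) (BorelProb.toMeasure μ) (liftSig Λ (robustESig r))

/-- The robust expected signature map of rank `r` on rank `r` signed measures, which is the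
identity for `r = 0`. -/
def robustESigM : ∀ r, MeasSp T V r → Ta α V r
  | 0 => fun x => x
  | r + 1 => fun μ => signedIntegral μ (liftSig Λ (robustESigM r))

end Robust

end

end HRSig

open HRSig

/-!
Everything is pushed through the evaluations `w ↦ ⟨w, Λ (S x)⟩` of a normalized signature at words
`w` of bounded linear functionals on `ℝ ⊕ E`. By the shuffle product formula their linear span is an
algebra of bounded functions of the path. Every increment has time component `1`, so the letter of
the time functional `e` reads off the scaling factor of `Λ`, and the words `f e ⋯ e` give the
integrals of all polynomials in time against `f` of the path; hence these functions separate paths.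
On the Polish space of paths a separating family of continuous functions generates the Borel
σ-algebra, and by the monotone class theorem a finite signed measure is determined by its integrals
against an algebra of bounded functions that generates the σ-algebra.

For the induction on the rank, injectivity alone is too weak, since the spaces of measures of higher
rank are not Polish. What is propagated is that the σ-algebra is pulled back along the robust map
from the Borel σ-algebra of the tensor algebra. Continuity comes from the Lévy–Prokhorov distance:
on a bounded set the integral of the identity is Lipschitz.
-/

namespace HRSig

open MeasureTheory Filter Topology
open scoped TensorProduct

section SignedIntegral

variable {X : Type u} [MeasurableSpace X]

theorem measurable_signedMeasure_apply {A : Set X} (hA : MeasurableSet A) :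
    Measurable fun μ : SignedMeasure X => μ A := by
  rw [measurable_iff_comap_le, BorelSpace.measurable_eq (α := ℝ)]
  exact le_iSup₂ (f := fun (A : Set X) (_ : MeasurableSet A) =>
    (borel ℝ).comap fun μ : SignedMeasure X => μ A) A hA

instance : MeasurableSpace.SeparatesPoints (SignedMeasure X) where
  separates _ _ h := VectorMeasure.ext fun _ hA => (h _
    (measurable_signedMeasure_apply hA (measurableSet_singleton _)) rfl).symm

variable {F : Type v} [NormedAddCommGroup F] [NormedSpace ℝ F] {f : X → F} {C : ℝ}

theorem signedIntegral_toSignedMeasure (P : Measure X) [IsFiniteMeasure P] :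
    signedIntegral P.toSignedMeasure f = ∫ x, f x ∂P := by
  have hj : P.toSignedMeasure.toJordanDecomposition =
      ⟨P, 0, Measure.MutuallySingular.zero_right⟩ :=
    SignedMeasure.toJordanDecomposition_eq (by simp [JordanDecomposition.toSignedMeasure])
  simp [signedIntegral, hj]

theorem signedIntegral_clm_comp {G : Type*} [NormedAddCommGroup G] [NormedSpace ℝ G]
    [CompleteSpace F] [CompleteSpace G] (l : F →L[ℝ] G) (μ : SignedMeasure X)
    (hf : StronglyMeasurable f) (hC : ∀ x, ‖f x‖ ≤ C) :
    signedIntegral μ (fun x => l (f x)) = l (signedIntegral μ f) := by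
  have hint (m : Measure X) [IsFiniteMeasure m] : Integrable f m :=
    .of_bound hf.aestronglyMeasurable C (.of_forall hC)
  rw [signedIntegral, signedIntegral, l.integral_comp_comm (hint _), l.integral_comp_comm (hint _),
    map_sub]

theorem norm_signedIntegral_le (hC : ∀ x, ‖f x‖ ≤ C) (μ : SignedMeasure X) :
    ‖signedIntegral μ f‖ ≤ C * μ.totalVariation.real Set.univ := by
  rw [SignedMeasure.totalVariation, measureReal_add_apply, mul_add]
  exact (norm_sub_le _ _).trans (add_le_add (norm_integral_le_of_norm_le_const
    (.of_forall hC)) (norm_integral_le_of_norm_le_const (.of_forall hC)))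

theorem tendsto_signedIntegral_of_bounded {b : ℕ → X → F} (μ : SignedMeasure X)
    (hb : ∀ n, StronglyMeasurable (b n)) (hC : ∀ n x, ‖b n x‖ ≤ C)
    (hlim : ∀ x, Tendsto (fun n => b n x) atTop (𝓝 (f x))) :
    Tendsto (fun n => signedIntegral μ (b n)) atTop (𝓝 (signedIntegral μ f)) := by
  have key (m : Measure X) [IsFiniteMeasure m] :
      Tendsto (fun n => ∫ x, b n x ∂m) atTop (𝓝 (∫ x, f x ∂m)) :=
    tendsto_integral_of_dominated_convergence (fun _ => C)
      (fun n => (hb n).aestronglyMeasurable) (integrable_const _)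
      (fun n => .of_forall (hC n)) (.of_forall hlim)
  exact (key _).sub (key _)

theorem signedIntegral_simpleFunc [CompleteSpace F] (μ : SignedMeasure X) (g : SimpleFunc X F) :
    signedIntegral μ g = ∑ y ∈ g.range, μ (g ⁻¹' {y}) • y := by
  have key (m : Measure X) [IsFiniteMeasure m] :
      ∫ x, g x ∂m = ∑ y ∈ g.range, m.real (g ⁻¹' {y}) • y :=
    (SimpleFunc.integral_eq_integral _ (SimpleFunc.integrable_of_isFiniteMeasure g)).symm.trans
      (SimpleFunc.integral_eq _ _)
  rw [signedIntegral, key, key, ← Finset.sum_sub_distrib]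
  exact Finset.sum_congr rfl fun y _ => by
    rw [μ.apply_eq_posPart_real_sub_negPart_real (g.measurableSet_fiber y), sub_smul]

theorem signedIntegral_indicator_one (μ : SignedMeasure X) {s : Set X} (hs : MeasurableSet s) :
    signedIntegral μ (s.indicator fun _ => (1 : ℝ)) = μ s := by
  rw [signedIntegral, integral_indicator_const _ hs, integral_indicator_const _ hs, ← sub_smul,
    ← μ.apply_eq_posPart_real_sub_negPart_real hs, smul_eq_mul, mul_one]

theorem measurable_signedIntegral [CompleteSpace F] [MeasurableSpace F] [BorelSpace F]
    [SecondCountableTopology F] (hf : StronglyMeasurable f) (hC : ∀ x, ‖f x‖ ≤ C) :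
    Measurable fun μ : SignedMeasure X => signedIntegral μ f := by
  cases isEmpty_or_nonempty X
  · simp [signedIntegral, Measure.eq_zero_of_isEmpty]
  have hC₀ : 0 ≤ C := (norm_nonneg _).trans (hC (Classical.arbitrary X))
  refine measurable_of_tendsto_metrizable
    (f := fun n μ => signedIntegral μ (hf.approxBounded C n)) (fun n => ?_)
    (tendsto_pi_nhds.mpr fun μ => tendsto_signedIntegral_of_bounded μ
      (fun n => (hf.approxBounded C n).stronglyMeasurable) (fun n => hf.norm_approxBounded_le hC₀ n)
      fun x => hf.tendsto_approxBounded_of_norm_le (hC x))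
  simp only [signedIntegral_simpleFunc]
  exact Finset.measurable_sum _ fun y _ => (measurable_signedMeasure_apply
    ((hf.approxBounded C n).measurableSet_fiber y)).smul_const y

end SignedIntegral

section BoundedLimits

variable {X : Type*} {𝒜 : Subalgebra ℝ (X → ℝ)} {a : X → ℝ} {s t : Set X} {C : ℝ}

/-- The indicator of `s` is a bounded pointwise limit of a sequence of functions in `𝒜`. The sets
with this property are the π-system of the monotone class argument for `𝒜`. -/
def IsBoundedLimit (𝒜 : Subalgebra ℝ (X → ℝ)) (s : Set X) : Prop :=
  ∃ (b : ℕ → X → ℝ) (C : ℝ), (∀ n, b n ∈ 𝒜) ∧ (∀ n x, ‖b n x‖ ≤ C) ∧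
    ∀ x, Tendsto (fun n => b n x) atTop (𝓝 (s.indicator (fun _ => (1 : ℝ)) x))

theorem IsBoundedLimit.inter (hs : IsBoundedLimit 𝒜 s) (ht : IsBoundedLimit 𝒜 t) :
    IsBoundedLimit 𝒜 (s ∩ t) := by
  obtain ⟨b, C, hb, hC, hlim⟩ := hs
  obtain ⟨b', C', hb', hC', hlim'⟩ := ht
  refine ⟨fun n => b n * b' n, C * C', fun n => 𝒜.mul_mem (hb n) (hb' n), fun n x => ?_,
    fun x => ?_⟩
  · simpa only [Pi.mul_apply, norm_mul] using
      mul_le_mul (hC n x) (hC' n x) (norm_nonneg _) ((norm_nonneg _).trans (hC n x))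
  · simpa only [← Set.inter_indicator_mul, mul_one, Pi.mul_apply] using (hlim x).mul (hlim' x)

theorem IsBoundedLimit.univ : IsBoundedLimit 𝒜 Set.univ :=
  ⟨fun _ => 1, 1, fun _ => 𝒜.one_mem, fun _ _ => by simp, fun _ => by simp⟩

theorem exists_mem_subalgebra_dist_comp_lt (ha : a ∈ 𝒜) (hC : ∀ x, ‖a x‖ ≤ C) {φ : ℝ → ℝ}
    (hφ : Continuous φ) {ε : ℝ} (hε : 0 < ε) : ∃ b ∈ 𝒜, ∀ x, dist (b x) (φ (a x)) < ε := by
  obtain ⟨p, hp⟩ := exists_polynomial_near_of_continuousOn (-C) C φ hφ.continuousOn ε hε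
  refine ⟨Polynomial.aeval a p, Algebra.adjoin_le (Set.singleton_subset_iff.mpr ha)
    (Polynomial.aeval_mem_adjoin_singleton ℝ a), fun x => ?_⟩
  simpa [Real.dist_eq] using hp (a x) (abs_le.mp (hC x))

theorem tendsto_min_one_mul_max (y : ℝ) :
    Tendsto (fun n : ℕ => min 1 (n * max y 0)) atTop
      (𝓝 ((Set.Ioi (0 : ℝ)).indicator (fun _ => (1 : ℝ)) y)) := by
  by_cases hy : 0 < y
  · rw [Set.indicator_of_mem (Set.mem_Ioi.mpr hy)]
    refine tendsto_const_nhds.congr' ?_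
    filter_upwards [(tendsto_natCast_atTop_atTop.atTop_mul_const hy).eventually_ge_atTop
      (1 : ℝ)] with n hn
    rw [max_eq_left hy.le, min_eq_left hn]
  · rw [Set.indicator_of_notMem (by simpa using hy), max_eq_right (not_lt.mp hy)]
    simp

theorem IsBoundedLimit.setOf_pos (ha : a ∈ 𝒜) (hC : ∀ x, ‖a x‖ ≤ C) :
    IsBoundedLimit 𝒜 {x | 0 < a x} := by
  choose b hb hdist using fun n : ℕ => exists_mem_subalgebra_dist_comp_lt ha hC
    (φ := fun y => min 1 (n * max y 0)) (by fun_prop) (Nat.one_div_pos_of_nat (n := n))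
  refine ⟨b, 2, hb, fun n x => ?_, fun x => ?_⟩
  · have hφ : ‖min 1 ((n : ℝ) * max (a x) 0)‖ ≤ 1 := by
      rw [Real.norm_of_nonneg (by positivity)]
      exact min_le_left _ _
    have hle : (1 : ℝ) / (n + 1) ≤ 1 := by
      simpa using Nat.one_div_le_one_div (α := ℝ) (Nat.zero_le n)
    linarith [norm_le_norm_add_norm_sub' (b n x) (min 1 ((n : ℝ) * max (a x) 0)),
      dist_eq_norm (b n x) (min 1 ((n : ℝ) * max (a x) 0)), hdist n x]
  · exact ((tendsto_iff_of_dist (squeeze_zero (fun _ => dist_nonneg)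
      (fun n => (hdist n x).le) tendsto_one_div_add_atTop_nhds_zero_nat)).mpr
      (tendsto_min_one_mul_max (a x)))

theorem iSup_comap_le_generateFrom_isBoundedLimit (hbdd : ∀ a ∈ 𝒜, ∃ C, ∀ x, ‖a x‖ ≤ C) :
    ⨆ a : 𝒜, (borel ℝ).comap (a : X → ℝ) ≤
      MeasurableSpace.generateFrom {s | IsBoundedLimit 𝒜 s} := by
  refine iSup_le fun a => ?_
  let : MeasurableSpace X := MeasurableSpace.generateFrom {s | IsBoundedLimit 𝒜 s}
  rw [← BorelSpace.measurable_eq (α := ℝ), ← measurable_iff_comap_le]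
  refine measurable_of_Ioi fun y => ?_
  obtain ⟨C, hC⟩ := hbdd _ (𝒜.sub_mem a.2 (𝒜.algebraMap_mem y))
  have hpre : (a : X → ℝ) ⁻¹' Set.Ioi y = {x | 0 < ((a : X → ℝ) - algebraMap ℝ (X → ℝ) y) x} := by
    ext x
    simp
  rw [hpre]
  exact MeasurableSpace.measurableSet_generateFrom
    (IsBoundedLimit.setOf_pos (𝒜.sub_mem a.2 (𝒜.algebraMap_mem y)) hC)

end BoundedLimits

section MonotoneClass

variable {X : Type u} [mX : MeasurableSpace X] {𝒜 : Subalgebra ℝ (X → ℝ)} {s : Set X}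

theorem IsBoundedLimit.measurableSet (hmeas : ∀ a ∈ 𝒜, Measurable a) (hs : IsBoundedLimit 𝒜 s) :
    MeasurableSet s := by
  obtain ⟨b, -, hb, -, hlim⟩ := hs
  exact (measurable_indicator_const_iff (1 : ℝ)).mp
    (measurable_of_tendsto_metrizable (fun n => hmeas _ (hb n)) (tendsto_pi_nhds.mpr hlim))

theorem IsBoundedLimit.measurable_apply {m : MeasurableSpace (SignedMeasure X)}
    (hmeas : ∀ a ∈ 𝒜, Measurable a) (h : ∀ a ∈ 𝒜, Measurable[m] fun μ => signedIntegral μ a)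
    (hs : IsBoundedLimit 𝒜 s) : Measurable[m] fun μ : SignedMeasure X => μ s := by
  simp only [← signedIntegral_indicator_one _ (hs.measurableSet hmeas)]
  obtain ⟨b, C, hb, hC, hlim⟩ := hs
  exact measurable_of_tendsto_metrizable (fun n => h _ (hb n)) (tendsto_pi_nhds.mpr fun μ =>
    tendsto_signedIntegral_of_bounded μ (fun n => (hmeas _ (hb n)).stronglyMeasurable) hC hlim)

theorem signedMeasurableSpace_le_of_measurable_signedIntegral
    {m : MeasurableSpace (SignedMeasure X)}
    (hX : mX = ⨆ a : 𝒜, (borel ℝ).comap (a : X → ℝ)) (hbdd : ∀ a ∈ 𝒜, ∃ C, ∀ x, ‖a x‖ ≤ C)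
    (h : ∀ a ∈ 𝒜, Measurable[m] fun μ : SignedMeasure X => signedIntegral μ a) :
    signedMeasurableSpace X ≤ m := by
  have hmeas : ∀ a ∈ 𝒜, Measurable a := fun a ha => by
    rw [measurable_iff_comap_le, BorelSpace.measurable_eq (α := ℝ), hX]
    exact le_iSup (fun a : 𝒜 => (borel ℝ).comap (a : X → ℝ)) ⟨a, ha⟩
  have hgen : mX = MeasurableSpace.generateFrom {s | IsBoundedLimit 𝒜 s} :=
    (hX.trans_le (iSup_comap_le_generateFrom_isBoundedLimit hbdd)).antisymm
      (MeasurableSpace.generateFrom_le fun s hs => hs.measurableSet hmeas)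
  refine iSup₂_le fun B hB => ?_
  rw [← BorelSpace.measurable_eq (α := ℝ), ← measurable_iff_comap_le]
  induction B, hB using MeasurableSpace.induction_on_inter hgen
    (fun s hs t ht _ => IsBoundedLimit.inter hs ht) with
  | empty => simp
  | basic s hs => exact hs.measurable_apply hmeas h
  | compl s hs ih =>
    have hcompl (μ : SignedMeasure X) : μ sᶜ = μ Set.univ - μ s := by
      rw [← VectorMeasure.of_add_of_sdiff hs MeasurableSet.univ (Set.subset_univ s),
        Set.compl_eq_univ_sdiff, add_sub_cancel_left]
    simp only [hcompl]
    exact (IsBoundedLimit.univ.measurable_apply hmeas h).sub ih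
  | iUnion f hd hf ih =>
    exact measurable_of_tendsto_metrizable (fun n => Finset.measurable_sum _ fun i _ => ih i)
      (tendsto_pi_nhds.mpr fun μ => by
        simpa using (VectorMeasure.hasSum_of_disjoint_iUnion (v := μ) hf hd).tendsto_sum_nat)

end MonotoneClass

section Comap

theorem injective_of_eq_comap {X Y : Type*} [m : MeasurableSpace X]
    [MeasurableSpace.SeparatesPoints X] {mY : MeasurableSpace Y} {f : X → Y}
    (h : m = mY.comap f) : Function.Injective f := by
  refine fun x y hxy => MeasurableSpace.SeparatesPoints.separates x y fun s hs hx => ?_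
  rw [h] at hs
  obtain ⟨t, -, rfl⟩ := hs
  rwa [Set.mem_preimage, ← hxy]

theorem pi_eq_comap_comp {ι X Y : Type*} {mX : MeasurableSpace X} {mY : MeasurableSpace Y}
    {g : X → Y} (h : mX = mY.comap g) :
    MeasurableSpace.pi (X := fun _ : ι => X) =
      (MeasurableSpace.pi (X := fun _ : ι => Y)).comap fun x t => g (x t) := by
  simp only [MeasurableSpace.pi, h, MeasurableSpace.comap_iSup, MeasurableSpace.comap_comp]
  rfl

theorem pi_eq_comap_borel {ι X Y : Type*} [Countable ι] [TopologicalSpace Y]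
    [SecondCountableTopology Y] {mX : MeasurableSpace X} {g : X → Y} (h : mX = (borel Y).comap g) :
    MeasurableSpace.pi (X := fun _ : ι => X) = (borel (ι → Y)).comap fun x t => g (x t) := by
  borelize Y
  rw [pi_eq_comap_comp h, BorelSpace.measurable_eq (α := ι → Y)]

theorem borel_pi_eq_comap {ι X Y : Type*} [Countable ι] [TopologicalSpace X]
    [SecondCountableTopology X] [TopologicalSpace Y] [SecondCountableTopology Y] {g : X → Y}
    (h : borel X = (borel Y).comap g) :
    borel (ι → X) = (borel (ι → Y)).comap fun x t => g (x t) := by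
  borelize X
  rw [← BorelSpace.measurable_eq (α := ι → X), pi_eq_comap_borel h]

theorem borel_eq_iSup_comap_of_separating {X Y ι : Type*} [TopologicalSpace X] [PolishSpace X]
    [TopologicalSpace Y] [T2Space Y] [SecondCountableTopology Y] {f : ι → X → Y}
    (hf : ∀ i, Continuous (f i)) (hsep : ∀ x y, (∀ i, f i x = f i y) → x = y) :
    borel X = ⨆ i, (borel Y).comap (f i) := by
  borelize X Y
  refine le_antisymm ?_ (iSup_le fun i => ?_)
  · obtain ⟨c, hc, hcU⟩ := TopologicalSpace.isOpen_iUnion_countable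
      (fun i => {z : X × X | f i z.1 ≠ f i z.2})
      (fun i => isOpen_ne_fun ((hf i).comp continuous_fst) ((hf i).comp continuous_snd))
    have : Countable c := hc.to_subtype
    let φ : X → c → Y := fun x i => f i x
    have hφ : Function.Injective φ := by
      refine fun x y hxy => hsep x y fun i => ?_
      by_contra hne
      have hmem : (x, y) ∈ ⋃ i, {z : X × X | f i z.1 ≠ f i z.2} := Set.mem_iUnion.mpr ⟨i, hne⟩
      rw [← hcU] at hmem
      obtain ⟨j, hj, hne'⟩ := Set.mem_iUnion₂.mp hmem
      exact hne' (congrFun hxy ⟨j, hj⟩)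
    have hemb : MeasurableEmbedding φ :=
      Continuous.measurableEmbedding (continuous_pi fun i : c => hf i) hφ
    rw [← BorelSpace.measurable_eq (α := X), ← hemb.comap_eq, MeasurableSpace.pi,
      MeasurableSpace.comap_iSup]
    refine iSup_le fun i => ?_
    rw [MeasurableSpace.comap_comp, BorelSpace.measurable_eq (α := Y)]
    exact le_iSup (fun i => (borel Y).comap (f i)) i
  · rw [← BorelSpace.measurable_eq (α := Y), ← BorelSpace.measurable_eq (α := X)]
    exact (hf i).measurable.comap_le

end Comap

section WeakTopology

variable {Ω : Type u} [TopologicalSpace Ω]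

theorem isOpen_setOf_lt_probabilityMeasure [MeasurableSpace Ω] [OpensMeasurableSpace Ω]
    [HasOuterApproxClosed Ω] {G : Set Ω} (hG : IsOpen G) (q : NNReal) :
    IsOpen {μ : ProbabilityMeasure Ω | q < μ G} := by
  simp only [← ENNReal.coe_lt_coe, ProbabilityMeasure.ennreal_coeFn_eq_coeFn_toMeasure]
  refine isOpen_iff_mem_nhds.mpr fun μ hμ => eventually_lt_of_lt_liminf (LT.lt.trans_le hμ ?_)
  exact ProbabilityMeasure.le_liminf_measure_open_of_tendsto (L := 𝓝 μ) tendsto_id hG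

variable [SecondCountableTopology Ω]

theorem isOpen_sUnion_of_subset_countableBasis {S : Set (Set Ω)}
    (hS : S ⊆ TopologicalSpace.countableBasis Ω) : IsOpen (⋃₀ S) :=
  isOpen_sUnion fun _ hs => TopologicalSpace.isOpen_of_mem_countableBasis (hS hs)

variable [MeasurableSpace Ω]

variable (Ω) in
/-- A countable subbasis of the topology of weak convergence, formed by the sets `{μ | q < μ G}`
for rational `q` and finite unions `G` of sets of a countable basis of `Ω`. -/
def weakSubbasis : Set (Set (ProbabilityMeasure Ω)) :=
  Set.image2 (fun S (q : ℚ) => {μ | Real.toNNReal q < μ (⋃₀ S)})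
    {S | S.Finite ∧ S ⊆ TopologicalSpace.countableBasis Ω} Set.univ

variable (Ω) in
theorem countable_weakSubbasis : (weakSubbasis Ω).Countable :=
  (Set.countable_ofPred_finite_subset (TopologicalSpace.countable_countableBasis Ω)).image2
    Set.countable_univ _

theorem exists_mem_weakSubbasis_lt (μ : ProbabilityMeasure Ω) {G : Set Ω} (hG : IsOpen G)
    {r : NNReal} (hr : r < μ G) : ∃ U ∈ weakSubbasis Ω, μ ∈ U ∧ ∀ ν ∈ U, r < ν G := by
  obtain ⟨S, hS, hlt, hsub⟩ := μ.exists_lt_measure_biUnion_of_isOpen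
    (S := TopologicalSpace.countableBasis Ω) (fun u hu x hx => by
      obtain ⟨s, hs, hxs, hsu⟩ :=
        (TopologicalSpace.isBasis_countableBasis Ω).exists_subset_of_mem_open hx hu
      exact ⟨s, hs, (TopologicalSpace.isOpen_of_mem_countableBasis hs).mem_nhds hxs, hsu⟩) hG hr
  obtain ⟨q, -, hrq, hq⟩ := (NNReal.lt_iff_exists_rat_btwn _ _).mp hlt
  simp only [← Finset.mem_coe, ← Set.sUnion_eq_biUnion] at hq hsub
  exact ⟨_, ⟨S, ⟨S.finite_toSet, hS⟩, q, trivial, rfl⟩, hq,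
    fun ν hν => (hrq.trans hν).trans_le (ν.apply_mono hsub)⟩

variable [OpensMeasurableSpace Ω] [HasOuterApproxClosed Ω]

theorem probabilityMeasure_eq_generateFrom_weakSubbasis :
    (inferInstance : TopologicalSpace (ProbabilityMeasure Ω)) =
      TopologicalSpace.generateFrom (weakSubbasis Ω) := by
  refine le_antisymm (le_generateFrom ?_) ?_
  · rintro _ ⟨S, ⟨-, hS⟩, q, -, rfl⟩
    exact isOpen_setOf_lt_probabilityMeasure (isOpen_sUnion_of_subset_countableBasis hS) _
  · let τ := TopologicalSpace.generateFrom (weakSubbasis Ω)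
    have : @SecondCountableTopology _ τ :=
      @SecondCountableTopology.mk _ τ ⟨_, countable_weakSubbasis Ω, rfl⟩
    rw [← continuous_id_iff_le, @continuous_iff_continuousAt _ _ τ]
    refine fun μ => ?_
    have : (@nhds _ τ μ).IsCountablyGenerated :=
      @FirstCountableTopology.nhds_generated_countable _ τ _ μ
    refine tendsto_of_forall_isOpen_le_liminf fun G hG => ?_
    refine (le_liminf_iff (isCoboundedUnder_ge_of_le (x := 1) _ (by simp))
      (by isBoundedDefault)).2 fun r hr => ?_
    obtain ⟨U, hU, hμU, hlt⟩ := exists_mem_weakSubbasis_lt μ hG hr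
    exact mem_of_superset ((@IsOpen.mem_nhds _ τ _ _
      (TopologicalSpace.isOpen_generateFrom_of_mem hU)) hμU) hlt

instance : SecondCountableTopology (ProbabilityMeasure Ω) :=
  ⟨⟨weakSubbasis Ω, countable_weakSubbasis Ω, probabilityMeasure_eq_generateFrom_weakSubbasis⟩⟩

theorem borel_probabilityMeasure_le_comap_toSignedMeasure :
    borel (ProbabilityMeasure Ω) ≤
      (signedMeasurableSpace Ω).comap
        fun P : ProbabilityMeasure Ω => (P : Measure Ω).toSignedMeasure := by
  rw [borel_eq_generateFrom_of_subbasis probabilityMeasure_eq_generateFrom_weakSubbasis]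
  refine MeasurableSpace.generateFrom_le ?_
  rintro _ ⟨S, ⟨-, hS⟩, q, -, rfl⟩
  have hmeas := (isOpen_sUnion_of_subset_countableBasis hS).measurableSet
  refine ⟨_, measurable_signedMeasure_apply hmeas
    (measurableSet_Ioi (a := ((q : ℝ).toNNReal : ℝ))), ?_⟩
  ext P
  simp only [Set.mem_preimage, Set.mem_Ioi, Measure.toSignedMeasure_apply_measurable hmeas]
  rfl

end WeakTopology

section WeakIntegral

theorem thickening_setOf_le_subset {Ω : Type*} [PseudoMetricSpace Ω] {g : Ω → ℝ}
    (hg : LipschitzWith 1 g) (ε t : ℝ) :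
    Metric.thickening ε {x | t ≤ g x} ⊆ {x | t ≤ g x + ε} := by
  intro x hx
  obtain ⟨y, hy : t ≤ g y, hxy⟩ := Metric.mem_thickening_iff.mp hx
  have hdist : |g x - g y| ≤ dist x y := by
    simpa only [Real.dist_eq, NNReal.coe_one, one_mul] using hg.dist_le_mul x y
  change t ≤ g x + ε
  linarith [abs_le.mp hdist]

open BoundedContinuousFunction in
theorem integral_le_of_levyProkhorovEDist_lt {Ω : Type*} [PseudoMetricSpace Ω] [MeasurableSpace Ω]
    [OpensMeasurableSpace Ω] {μ ν : Measure Ω} [IsFiniteMeasure μ] [IsProbabilityMeasure ν]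
    {ε : ℝ} (hε : 0 < ε) (hμν : levyProkhorovEDist μ ν < ENNReal.ofReal ε) {g : Ω →ᵇ ℝ}
    (hg : LipschitzWith 1 g) (hg₀ : 0 ≤ g) :
    ∫ x, g x ∂μ ≤ ∫ x, g x ∂ν + ε * (1 + ‖g‖) := by
  let gε : Ω →ᵇ ℝ := g + const Ω ε
  have hle (x : Ω) : g x ≤ gε x := by simp [gε, hε.le]
  have hnorm : ‖g‖ ≤ ‖gε‖ := (norm_le (norm_nonneg _)).mpr fun x =>
    (abs_le_abs_of_nonneg (hg₀ x) (hle x)).trans (gε.norm_coe_le_norm x)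
  have hint {s : ℝ → Set Ω} (hs : Antitone s) (c : ℝ) :
      IntegrableOn (fun t => ν.real (s t)) (Set.Ioc 0 c) :=
    Measure.integrableOn_of_bounded (M := 1) measure_Ioc_lt_top.ne
      (Antitone.measurable fun _ _ h => measureReal_mono (hs h)).aestronglyMeasurable
      (.of_forall fun t => by simp [abs_of_nonneg])
  have hanti (g : Ω →ᵇ ℝ) : Antitone fun t : ℝ => {x | t ≤ g x} := fun _ _ h _ h' => h.trans h'
  calc ∫ x, g x ∂μ
      ≤ (∫ t in Set.Ioc 0 ‖g‖, ν.real (Metric.thickening ε {x | t ≤ g x})) + ε * ‖g‖ :=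
        g.integral_le_of_levyProkhorovEDist_lt μ ν hε hμν (.of_forall hg₀)
    _ ≤ (∫ t in Set.Ioc 0 ‖g‖, ν.real {x | t ≤ gε x}) + ε * ‖g‖ := by
        gcongr ?_ + _
        exact setIntegral_mono
          (hint (fun _ _ h => Metric.thickening_subset_of_subset ε (hanti g h)) _)
          (hint (hanti gε) _) fun t => measureReal_mono (thickening_setOf_le_subset hg ε t)
    _ ≤ (∫ t in Set.Ioc 0 ‖gε‖, ν.real {x | t ≤ gε x}) + ε * ‖g‖ := by
        gcongr ?_ + _
        exact setIntegral_mono_set (hint (hanti gε) _) (.of_forall fun _ => measureReal_nonneg)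
          (Set.Ioc_subset_Ioc_right hnorm).eventuallyLE
    _ = ∫ x, gε x ∂ν + ε * ‖g‖ := by
        rw [gε.integral_eq_integral_meas_le ν (.of_forall fun x => (hg₀ x).trans (hle x))]
    _ = ∫ x, g x ∂ν + ε * (1 + ‖g‖) := by
        have : ∫ x, gε x ∂ν = ∫ x, g x ∂ν + ε := by
          simp [gε, integral_add (g.integrable ν) (integrable_const ε)]
        linarith

variable {G : Type*} [NormedAddCommGroup G] [NormedSpace ℝ G] [CompleteSpace G]
  [SecondCountableTopology G]

theorem norm_integral_sub_integral_le_of_levyProkhorovEDist_lt {Ω : Type*} [PseudoMetricSpace Ω]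
    [MeasurableSpace Ω] [OpensMeasurableSpace Ω] {μ ν : Measure Ω} [IsProbabilityMeasure μ]
    [IsProbabilityMeasure ν] {ε : ℝ}
    (hε : 0 < ε) (hμν : levyProkhorovEDist μ ν < ENNReal.ofReal ε) {f : Ω → G} {K : ℝ}
    (hf : LipschitzWith 1 f) (hK : ∀ x, ‖f x‖ ≤ K) :
    ‖∫ x, f x ∂μ - ∫ x, f x ∂ν‖ ≤ ε * (1 + 2 * K) := by
  obtain ⟨l, hl, hlf⟩ := exists_dual_vector'' ℝ (∫ x, f x ∂μ - ∫ x, f x ∂ν)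
  have hint (m : Measure Ω) [IsProbabilityMeasure m] : Integrable f m :=
    .of_bound hf.continuous.aestronglyMeasurable K (.of_forall hK)
  have hlK (x : Ω) : |l (f x)| ≤ K := (l.le_of_opNorm_le hl _).trans (by simpa using hK x)
  have hle (x : Ω) : ‖l (f x) + K‖ ≤ 2 * K := abs_le.mpr (by
    constructor <;> linarith [abs_le.mp (hlK x)])
  have hK₀ : 0 ≤ 2 * K := (norm_nonneg _).trans (hle μ.nonempty_of_neZero.some)
  let g : BoundedContinuousFunction Ω ℝ := .ofNormedAddCommGroup (fun x => l (f x) + K)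
    (by have := hf.continuous; fun_prop) (2 * K) hle
  have hg : LipschitzWith 1 g := .of_dist_le_mul fun x y => calc
    dist (g x) (g y) = ‖l (f x - f y)‖ := by simp [g, Real.dist_eq, map_sub]
    _ ≤ 1 * dist (f x) (f y) := by rw [dist_eq_norm]; exact l.le_of_opNorm_le hl _
    _ ≤ 1 * dist x y := by gcongr; simpa using hf.dist_le_mul x y
  have hgint (m : Measure Ω) [IsProbabilityMeasure m] : ∫ x, g x ∂m = l (∫ x, f x ∂m) + K := by
    rw [← l.integral_comp_comm (hint m)]
    simp [g, integral_add (l.integrable_comp (hint m)) (integrable_const K)]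
  have hg₀ : 0 ≤ g := fun x => by
    change 0 ≤ l (f x) + K
    linarith [abs_le.mp (hlK x)]
  have hnorm : ‖g‖ ≤ 2 * K := BoundedContinuousFunction.norm_ofNormedAddCommGroup_le _ hK₀ hle
  calc ‖∫ x, f x ∂μ - ∫ x, f x ∂ν‖ = l (∫ x, f x ∂μ) - l (∫ x, f x ∂ν) := by
        rw [← map_sub, hlf]; rfl
    _ = ∫ x, g x ∂μ - ∫ x, g x ∂ν := by rw [hgint, hgint]; ring
    _ ≤ ε * (1 + ‖g‖) :=
        sub_le_iff_le_add'.mpr (integral_le_of_levyProkhorovEDist_lt hε hμν hg hg₀)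
    _ ≤ ε * (1 + 2 * K) := by gcongr

theorem continuous_integral_coe_levyProkhorov {s : Set G} {K : ℝ} (hK : ∀ x ∈ s, ‖x‖ ≤ K)
    [MeasurableSpace s] [BorelSpace s] :
    Continuous fun P : LevyProkhorov (ProbabilityMeasure s) =>
      ∫ y : s, (y : G) ∂(P.toMeasure : Measure s) := by
  refine (LipschitzWith.of_dist_le_mul (K := (1 + 2 * K).toNNReal) fun P Q => ?_).continuous
  have hK₀ : 0 ≤ K := by
    obtain ⟨y⟩ := (P.toMeasure : Measure s).nonempty_of_neZero
    exact (norm_nonneg _).trans (hK y y.2)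
  rw [Real.coe_toNNReal _ (by positivity), mul_comm, dist_eq_norm]
  refine le_of_forall_gt_imp_ge_of_dense fun c hc => ?_
  have hε : dist P Q < c / (1 + 2 * K) := by rwa [lt_div_iff₀ (by positivity)]
  have hPQ : levyProkhorovEDist (P.toMeasure : Measure s) Q.toMeasure <
      ENNReal.ofReal (c / (1 + 2 * K)) := by
    rwa [← LevyProkhorov.edist_probabilityMeasure_def, edist_lt_ofReal]
  have h := norm_integral_sub_integral_le_of_levyProkhorovEDist_lt (dist_nonneg.trans_lt hε) hPQ
    (LipschitzWith.subtype_val s) fun y => hK y y.2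
  rwa [div_mul_cancel₀ _ (by positivity)] at h

theorem continuous_integral_of_bounded {Ω : Type*} [TopologicalSpace Ω] [MeasurableSpace Ω]
    [OpensMeasurableSpace Ω] {f : Ω → G} (hf : Continuous f) {K : ℝ} (hK : ∀ x, ‖f x‖ ≤ K) :
    Continuous fun P : ProbabilityMeasure Ω => ∫ x, f x ∂(P : Measure Ω) := by
  let B : Set G := Metric.closedBall 0 K
  let : MeasurableSpace B := borel B
  have : BorelSpace B := ⟨rfl⟩
  let fB : Ω → B := fun x => ⟨f x, by simpa [B] using hK x⟩
  have hfB : Continuous fB := hf.subtype_mk _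
  have hmap (P : ProbabilityMeasure Ω) : ∫ x, f x ∂(P : Measure Ω) =
      ∫ y : B, (y : G) ∂(P.map hfB.measurable.aemeasurable : Measure B) :=
    (integral_map hfB.measurable.aemeasurable continuous_subtype_val.aestronglyMeasurable).symm
  simp only [hmap]
  exact (continuous_integral_coe_levyProkhorov fun x hx => by simpa [B] using hx).comp
    (LevyProkhorov.continuous_ofMeasure_probabilityMeasure.comp
      (ProbabilityMeasure.continuous_map hfB))

end WeakIntegral

section SummableFamilies

variable {β : Type*} {G : β → Type*} [∀ m, NormedAddCommGroup (G m)]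

theorem hasSum_norm_lp_one (f : lp G 1) : HasSum (fun m => ‖f m‖) ‖f‖ := by
  simpa using lp.hasSum_norm (by simp) f

theorem tendsto_lp_one_of_dominated {ι : Type*} {l : Filter ι} {f : ι → lp G 1} {g : lp G 1}
    {b : β → ℝ} (hb : Summable b) (hle : ∀ᶠ i in l, ∀ m, ‖f i m‖ ≤ b m)
    (h : ∀ m, Tendsto (fun i => f i m) l (𝓝 (g m))) : Tendsto f l (𝓝 g) := by
  have hzero : Tendsto (fun i => ∑' m, ‖(f i - g) m‖) l (𝓝 (∑' _ : β, 0)) := by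
    refine tendsto_tsum_of_dominated_convergence (hb.add (hasSum_norm_lp_one g).summable)
      (fun m => tendsto_iff_norm_sub_tendsto_zero.mp (h m)) ?_
    filter_upwards [hle] with i hi m
    rw [norm_norm]
    exact (norm_sub_le _ _).trans (add_le_add_left (hi m) _)
  simpa only [(hasSum_norm_lp_one _).tsum_eq, tsum_zero,
    ← tendsto_iff_norm_sub_tendsto_zero] using hzero

theorem separableSpace_lp_one [Countable β] [∀ m, NormedSpace ℝ (G m)]
    [∀ m, TopologicalSpace.SeparableSpace (G m)] : TopologicalSpace.SeparableSpace (lp G 1) := by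
  classical
  rw [← TopologicalSpace.isSeparable_univ_iff]
  have hsingle : TopologicalSpace.IsSeparable (⋃ m, Set.range (lp.single (E := G) 1 m)) :=
    .iUnion fun m => TopologicalSpace.isSeparable_range (lp.isometry_single m).continuous
  refine (hsingle.span (R := ℝ)).closure.mono fun f _ => ?_
  refine mem_closure_of_tendsto (lp.hasSum_single (by simp) f) (.of_forall fun s => ?_)
  exact Submodule.sum_mem _ fun m _ =>
    Submodule.subset_span (Set.mem_iUnion.mpr ⟨m, f m, rfl⟩)

end SummableFamilies

section Normalization

variable {G : ℕ → Type*} [∀ m, NormedAddCommGroup (G m)] [∀ m, NormedSpace ℝ (G m)]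

/-- The dilation `(tₘ)ₘ ↦ (c ^ m tₘ)ₘ` with a factor `c ∈ [0, 1]`. -/
noncomputable def dilation (c : unitInterval) : lp G 1 →L[ℝ] lp G 1 :=
  lp.mapCLM 1 (fun m => (c : ℝ) ^ m • ContinuousLinearMap.id ℝ (G m)) zero_le_one fun m => by
    refine (norm_smul_le _ _).trans (mul_le_one₀ ?_ (norm_nonneg _)
      ContinuousLinearMap.norm_id_le)
    rw [Real.norm_of_nonneg (pow_nonneg c.2.1 m)]
    exact pow_le_one₀ c.2.1 c.2.2

theorem dilation_apply (c : unitInterval) (t : lp G 1) (m : ℕ) :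
    dilation c t m = (c : ℝ) ^ m • t m := rfl

theorem norm_dilation_apply (c : unitInterval) (t : lp G 1) (m : ℕ) :
    ‖dilation c t m‖ = (c : ℝ) ^ m * ‖t m‖ := by
  rw [dilation_apply, norm_smul, Real.norm_of_nonneg (pow_nonneg c.2.1 m)]

theorem norm_dilation_mono (t : lp G 1) : Monotone fun c => ‖dilation c t‖ := fun c d h =>
  lp.norm_mono one_ne_zero fun m => by
    rw [norm_dilation_apply, norm_dilation_apply]
    exact mul_le_mul_of_nonneg_right (pow_le_pow_left₀ c.2.1 h m) (norm_nonneg _)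

theorem dilation_one (t : lp G 1) : dilation 1 t = t := by
  ext m
  simp [dilation_apply]

theorem norm_dilation_le (c : unitInterval) (t : lp G 1) : ‖dilation c t‖ ≤ ‖t‖ :=
  (norm_dilation_mono t unitInterval.le_one').trans_eq (by simp only [dilation_one])

theorem norm_dilation_zero (t : lp G 1) : ‖dilation 0 t‖ = ‖t 0‖ := by
  have hsum := hasSum_norm_lp_one (dilation 0 t)
  simp only [norm_dilation_apply] at hsum
  simpa using hsum.unique (hasSum_single 0 fun m hm => by simp [hm])

theorem continuous_dilation (t : lp G 1) : Continuous fun c => dilation c t := by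
  refine continuous_iff_continuousAt.mpr fun c => ?_
  refine tendsto_lp_one_of_dominated (hasSum_norm_lp_one t).summable
    (.of_forall fun c m => ?_) fun m => ?_
  · rw [norm_dilation_apply]
    exact mul_le_of_le_one_left (norm_nonneg _) (pow_le_one₀ c.2.1 c.2.2)
  · have : Continuous fun c : unitInterval => (c : ℝ) ^ m • t m := by fun_prop
    exact this.tendsto c

/-- The strictly increasing function `c ↦ c + ∑_{m ≥ 1} c ^ m ‖tₘ‖`, whose value `1` determines how
far the normalization contracts `t`. -/
noncomputable def levelSum (t : lp G 1) (c : unitInterval) : ℝ :=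
  c + (‖dilation c t‖ - ‖t 0‖)

theorem abs_sub_le_abs_levelSum_sub (t : lp G 1) (c d : unitInterval) :
    |(c : ℝ) - d| ≤ |levelSum t c - levelSum t d| := by
  wlog h : d ≤ c generalizing c d
  · rw [abs_sub_comm, abs_sub_comm (levelSum t c)]
    exact this d c (le_of_not_ge h)
  have hle : (d : ℝ) ≤ c := h
  have hmono : ‖dilation d t‖ ≤ ‖dilation c t‖ := norm_dilation_mono t h
  refine (abs_of_nonneg (sub_nonneg.mpr hle)).trans_le (le_trans ?_ (le_abs_self _))
  unfold levelSum
  linarith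

theorem exists_levelSum_eq_one (t : lp G 1) : ∃ c : unitInterval, levelSum t c = 1 := by
  have hc : Continuous (levelSum t) :=
    continuous_subtype_val.add ((continuous_dilation t).norm.sub continuous_const)
  refine mem_range_of_exists_le_of_exists_ge hc ⟨0, ?_⟩ ⟨1, ?_⟩
  · simp [levelSum, norm_dilation_zero]
  · have := lp.norm_apply_le_norm one_ne_zero t 0
    simpa [levelSum, dilation_one] using this

/-- The solution `c` of `c + ∑_{m ≥ 1} c ^ m ‖tₘ‖ = 1`. -/
noncomputable def dilationFactor (t : lp G 1) : unitInterval := (exists_levelSum_eq_one t).choose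

theorem levelSum_dilationFactor (t : lp G 1) : levelSum t (dilationFactor t) = 1 :=
  (exists_levelSum_eq_one t).choose_spec

theorem dilationFactor_pos (t : lp G 1) : 0 < (dilationFactor t : ℝ) := by
  refine unitInterval.pos_iff_ne_zero.mpr fun h => ?_
  simpa [h, levelSum, norm_dilation_zero] using levelSum_dilationFactor t

theorem abs_levelSum_sub_le (t s : lp G 1) (c : unitInterval) :
    |levelSum t c - levelSum s c| ≤ 2 * ‖t - s‖ := by
  have hdil : |‖dilation c t‖ - ‖dilation c s‖| ≤ ‖t - s‖ := by
    refine (abs_norm_sub_norm_le _ _).trans ?_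
    rw [← map_sub]
    exact norm_dilation_le c _
  have hzero : |‖t 0‖ - ‖s 0‖| ≤ ‖t - s‖ :=
    (abs_norm_sub_norm_le _ _).trans (lp.norm_apply_le_norm one_ne_zero (t - s) 0)
  rw [abs_le] at hdil hzero ⊢
  unfold levelSum
  constructor <;> linarith

theorem lipschitzWith_dilationFactor :
    LipschitzWith 2 fun t : lp G 1 => (dilationFactor t : ℝ) := by
  refine LipschitzWith.of_dist_le_mul fun t s => ?_
  rw [Real.dist_eq, dist_eq_norm]
  refine (abs_sub_le_abs_levelSum_sub t _ _).trans ?_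
  rw [levelSum_dilationFactor, ← levelSum_dilationFactor s, abs_sub_comm]
  exact abs_levelSum_sub_le t s _

/-- The dilation by the dilation factor, a tensor normalization on the tensor algebra. -/
noncomputable def tensorNormalization (t : lp G 1) : lp G 1 := dilation (dilationFactor t) t

theorem norm_tensorNormalization (t : lp G 1) :
    ‖tensorNormalization t‖ = ‖t 0‖ + 1 - dilationFactor t := by
  rw [tensorNormalization, ← levelSum_dilationFactor t, levelSum]
  ring

theorem continuous_tensorNormalization : Continuous (tensorNormalization (G := G)) := by
  refine continuous_iff_continuousAt.mpr fun s => ?_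
  have hsub : Tendsto (fun t : lp G 1 => dilation (dilationFactor t) (t - s)) (𝓝 s) (𝓝 0) :=
    squeeze_zero_norm (fun t => norm_dilation_le _ _)
      (tendsto_iff_norm_sub_tendsto_zero.mp tendsto_id)
  have hfactor : Continuous (dilationFactor (G := G)) :=
    lipschitzWith_dilationFactor.continuous.subtype_mk _
  have hs := ((continuous_dilation s).comp hfactor).tendsto s
  simpa [ContinuousAt, tensorNormalization] using! hsub.add hs

theorem injOn_tensorNormalization (z : G 0) :
    Set.InjOn (tensorNormalization (G := G)) {t | t 0 = z} := by
  intro t (ht : t 0 = z) s (hs : s 0 = z) h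
  have hnorm := norm_tensorNormalization t
  rw [h, norm_tensorNormalization, ht, hs] at hnorm
  have hfactor : (dilationFactor t : ℝ) = dilationFactor s := by linarith
  ext m
  have hm := congrArg (fun r : lp G 1 => r m) h
  simp only [tensorNormalization, dilation_apply, hfactor] at hm
  exact smul_right_injective _ (pow_pos (dilationFactor_pos s) m).ne' hm

theorem isTensorNormalization_tensorNormalization (α : AdmissibleNorm.{u}) (E : Type u)
    [NormedAddCommGroup E] [NormedSpace ℝ E] :
    IsTensorNormalization α (E := E) tensorNormalization := by
  refine ⟨⟨fun t => dilationFactor t, fun t _ => ⟨dilationFactor_pos t, fun m => rfl⟩⟩,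
    ⟨‖toCompletion α (TimeExt E) 0 (tone 0)‖ + 1, fun t (ht : t 0 = _) => ?_⟩,
    continuous_tensorNormalization.continuousOn, injOn_tensorNormalization _⟩
  rw [norm_tensorNormalization, ht]
  linarith [dilationFactor_pos t]

end Normalization

theorem add_pow_div_factorial {K : Type*} [Field K] [CharZero K] (a b : K) (n : ℕ) :
    (a + b) ^ n / n.factorial =
      ∑ i ∈ Finset.range (n + 1), a ^ i / i.factorial * (b ^ (n - i) / (n - i).factorial) := by
  rw [add_pow, Finset.sum_div]
  refine Finset.sum_congr rfl fun i hi => ?_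
  have hn : (n.factorial : K) ≠ 0 := Nat.cast_ne_zero.mpr n.factorial_ne_zero
  rw [Nat.cast_choose K (Finset.mem_range_succ_iff.mp hi)]
  field_simp

section TensorPowers

variable (α : AdmissibleNorm.{u}) {E : Type u} [NormedAddCommGroup E] [NormedSpace ℝ E]

/-- The identity map from the algebraic tensor power to its seminormed type synonym. -/
def toTPow (m : ℕ) : (⨂[ℝ]^m E) ≃ₗ[ℝ] TPow α E m := LinearEquiv.refl ℝ (⨂[ℝ]^m E)

theorem continuous_toTPow_tprod (m : ℕ) :
    Continuous fun v : Fin m → E => toTPow α m (PiTensorProduct.tprod ℝ v) :=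
  MultilinearMap.continuous_of_bound ((toTPow α m).toLinearMap.compMultilinearMap
    (PiTensorProduct.tprod ℝ (s := fun _ : Fin m => E))) 1 fun v => by
      rw [one_mul]; exact α.tprod_le E m v

instance separableSpace_TPow [TopologicalSpace.SeparableSpace E] (m : ℕ) :
    TopologicalSpace.SeparableSpace (TPow α E m) := by
  rw [← TopologicalSpace.isSeparable_univ_iff]
  have hspan : Submodule.span ℝ (Set.range fun v : Fin m → E =>
      toTPow α m (PiTensorProduct.tprod ℝ v)) = ⊤ := by
    have h := congrArg (Submodule.map (toTPow α m).toLinearMap)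
      (PiTensorProduct.span_tprod_eq_top (R := ℝ) (s := fun _ : Fin m => E))
    rwa [Submodule.map_span, ← Set.range_comp, Submodule.map_top, LinearEquiv.range] at h
  have h := (TopologicalSpace.isSeparable_range (continuous_toTPow_tprod α (E := E) m)).span
    (R := ℝ)
  rwa [hspan] at h

/-- The product `E ^ ⊗ i × E ^ ⊗ j → E ^ ⊗ m` of tensors, for `i + j = m`, as a continuous bilinear
map. -/
noncomputable def tpowMul {i j m : ℕ} (h : i + j = m) :
    TPow α E i →L[ℝ] TPow α E j →L[ℝ] TPow α E m :=
  let B : TPow α E i →ₗ[ℝ] TPow α E j →ₗ[ℝ] TPow α E m :=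
    (TensorProduct.mk ℝ (⨂[ℝ]^i E) (⨂[ℝ]^j E)).compr₂
      ((TensorPower.mulEquiv.trans (TensorPower.cast ℝ E h)).trans (toTPow α m)).toLinearMap
  B.mkContinuous₂ 1 fun a b => by
    rw [one_mul]
    exact (seminorm_cast α h _).trans_le (α.mul_le E i j a b)

theorem toTPow_tconv (s t : ∀ m : ℕ, ⨂[ℝ]^m E) (m : ℕ) :
    toTPow α m (tconv s t m) = ∑ i : Fin (m + 1),
      tpowMul α (Nat.add_sub_cancel' (Nat.lt_succ_iff.mp i.2)) (toTPow α i (s i))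
        (toTPow α (m - i) (t (m - i))) :=
  map_sum (toTPow α m) _ _

theorem continuous_tconv {X : Type*} [TopologicalSpace X] {s t : X → ∀ m : ℕ, ⨂[ℝ]^m E}
    (hs : ∀ m, Continuous fun x => toTPow α m (s x m))
    (ht : ∀ m, Continuous fun x => toTPow α m (t x m)) (m : ℕ) :
    Continuous fun x => toTPow α m (tconv (s x) (t x) m) := by
  simp only [toTPow_tconv]
  exact continuous_finsetSum _ fun i _ =>
    ((tpowMul α _).continuous.comp (hs i)).clm_apply (ht (m - i))

theorem seminorm_tconv_le {s t : ∀ m : ℕ, ⨂[ℝ]^m E} {a b : ℝ}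
    (hs : ∀ m, α.seminorm E m (s m) ≤ a ^ m / m.factorial)
    (ht : ∀ m, α.seminorm E m (t m) ≤ b ^ m / m.factorial) (m : ℕ) :
    α.seminorm E m (tconv s t m) ≤ (a + b) ^ m / m.factorial := by
  rw [add_pow_div_factorial, Finset.sum_range]
  refine (Finset.le_sum_of_subadditive (α.seminorm E m) (map_zero (α.seminorm E m)).le
    (map_add_le_add _) _ _).trans (Finset.sum_le_sum fun i _ => ?_)
  rw [seminorm_cast]
  exact (α.mul_le E _ _ _ _).trans (mul_le_mul (hs i) (ht _) (apply_nonneg _ _)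
    ((apply_nonneg _ _).trans (hs i)))

theorem continuous_texp (m : ℕ) : Continuous fun v : E => toTPow α m (texp v m) :=
  ((continuous_toTPow_tprod α m).comp (continuous_pi fun _ => continuous_id)).const_smul
    (m.factorial : ℝ)⁻¹

theorem seminorm_texp_le (v : E) (m : ℕ) :
    α.seminorm E m (texp v m) ≤ ‖v‖ ^ m / m.factorial := by
  rw [texp, map_smul_eq_mul, Real.norm_of_nonneg (by positivity), div_eq_inv_mul]
  refine mul_le_mul_of_nonneg_left ?_ (by positivity)
  simpa using α.tprod_le E m (fun _ => v)

theorem texp_zero (v : E) : texp v 0 = tone 0 := by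
  simp [texp, tone, Subsingleton.elim (fun _ : Fin 0 => v) fun _ => 0]

theorem tconv_apply_zero {s t : ∀ m : ℕ, ⨂[ℝ]^m E} (hs : s 0 = tone 0) (ht : t 0 = tone 0) :
    tconv s t 0 = tone 0 := by
  refine (Fin.sum_univ_one _).trans ?_
  change TensorPower.cast ℝ E _ (GradedMonoid.GMul.mul (A := fun i => ⨂[ℝ]^i E) (s 0) (t 0)) = _
  rw [hs, ht, tone, TensorPower.tprod_mul_tprod, TensorPower.cast_tprod]
  exact congrArg _ (Subsingleton.elim _ _)

/-- The ordered product `exp v₁ ⋯ exp vₙ` of the exponentials of the vectors in a list; the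
signature is the case of the increments of a path. -/
noncomputable def expProd (l : List E) : ∀ m : ℕ, ⨂[ℝ]^m E :=
  l.foldr (fun v s => tconv (texp v) s) tone

theorem expProd_cons (v : E) (l : List E) : expProd (v :: l) = tconv (texp v) (expProd l) := rfl

theorem expProd_apply_zero (l : List E) : expProd l 0 = tone 0 := by
  induction l with
  | nil => rfl
  | cons v l ih => exact tconv_apply_zero (texp_zero v) ih

theorem continuous_expProd_ofFn (n m : ℕ) :
    Continuous fun v : Fin n → E => toTPow α m (expProd (List.ofFn v) m) := by
  induction n generalizing m with
  | zero => simp only [List.ofFn_zero]; exact continuous_const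
  | succ n ih =>
    simp only [List.ofFn_succ, expProd_cons]
    exact continuous_tconv α (s := fun v : Fin (n + 1) → E => texp (v 0))
      (t := fun v => expProd (List.ofFn fun i => v i.succ))
      (fun m => (continuous_texp α m).comp (continuous_apply 0))
      (fun m => (ih m).comp (continuous_pi fun i => continuous_apply i.succ)) m

theorem seminorm_expProd_le (l : List E) (m : ℕ) :
    α.seminorm E m (expProd l m) ≤ (l.map norm).sum ^ m / m.factorial := by
  induction l generalizing m with
  | nil =>
    cases m with
    | zero => simpa [expProd, tone] using α.tprod_le E 0 (fun _ => 0)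
    | succ m => simp [expProd, tone]
  | cons v l ih =>
    rw [List.map_cons, List.sum_cons]
    exact seminorm_tconv_le α (seminorm_texp_le α v) ih m

end TensorPowers

section Signature

variable (α : AdmissibleNorm.{u}) {E : Type u} [NormedAddCommGroup E] [NormedSpace ℝ E]

instance separableSpace_timeExt [TopologicalSpace.SeparableSpace E] :
    TopologicalSpace.SeparableSpace (TimeExt E) :=
  (WithLp.toLp_surjective 1).denseRange.separableSpace (WithLp.prod_continuous_toLp 1 ℝ E)

instance separableSpace_TA [TopologicalSpace.SeparableSpace E] :
    TopologicalSpace.SeparableSpace (TA α E) :=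
  separableSpace_lp_one

theorem continuous_incr {E : Type*} [NormedAddCommGroup E] {T : ℕ} :
    Continuous fun x : Fin (T + 1) → E => incr x := by
  refine continuous_pi (Fin.cases ?_ fun t => ?_) <;>
    refine (WithLp.prod_continuous_toLp 1 ℝ E).comp (continuous_const.prodMk ?_) <;>
    fun_prop

theorem continuous_sig {T : ℕ} : Continuous fun x : Fin (T + 1) → E => sig α x := by
  refine continuous_iff_continuousAt.mpr fun x₀ => ?_
  set R : (Fin (T + 1) → E) → ℝ := fun x => ((List.ofFn (incr x)).map norm).sum with hR
  have hR_cont : Continuous R := by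
    simp only [hR, List.map_ofFn, List.sum_ofFn, Function.comp_def]
    exact continuous_finsetSum _ fun i _ => ((continuous_apply i).comp continuous_incr).norm
  have hR_nonneg : ∀ x, 0 ≤ R x := fun x => List.sum_nonneg (by simp)
  refine tendsto_lp_one_of_dominated (b := fun m => (R x₀ + 1) ^ m / m.factorial)
    (Real.summable_pow_div_factorial _) ?_ fun m => ?_
  · filter_upwards [hR_cont.continuousAt.eventually_lt_const (lt_add_one (R x₀))] with x hx m
    refine (norm_toCompletion α _ m (sigSeries x m)).trans_le
      ((seminorm_expProd_le α _ m).trans ?_)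
    have := hR_nonneg x
    gcongr
  · exact ((UniformSpace.Completion.continuous_coe (TPow α (TimeExt E) m)).comp
      ((continuous_expProd_ofFn α (T + 1) m).comp continuous_incr)).tendsto x₀

theorem sig_mem_unitLevel {T : ℕ} (x : Fin (T + 1) → E) : sig α x ∈ unitLevel α E :=
  congrArg (toCompletion α _ 0) (expProd_apply_zero _)

end Signature

section Shuffle

variable {D : Type*}

/-- The list, with multiplicities, of all shuffles of two words. -/
def shuffle : List D → List D → List (List D)
  | [], w => [w]
  | u, [] => [u]
  | a :: u, b :: w => (shuffle u (b :: w)).map (a :: ·) ++ (shuffle (a :: u) w).map (b :: ·)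
  termination_by u w => u.length + w.length

theorem shuffle_nil_left (w : List D) : shuffle [] w = [w] := by
  rw [shuffle]

theorem shuffle_nil_right (u : List D) : shuffle u [] = [u] := by
  cases u with
  | nil => rw [shuffle]
  | cons a u => rw [shuffle]; simp

theorem shuffle_cons_cons (a b : D) (u w : List D) :
    shuffle (a :: u) (b :: w) =
      (shuffle u (b :: w)).map (a :: ·) ++ (shuffle (a :: u) w).map (b :: ·) := by
  rw [shuffle]

theorem length_of_mem_shuffle {u w z : List D} (hz : z ∈ shuffle u w) :
    z.length = u.length + w.length := by
  induction u, w using shuffle.induct generalizing z with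
  | case1 w => simp_all [shuffle_nil_left]
  | case2 u _ => simp_all [shuffle_nil_right]
  | case3 a u b w ih₁ ih₂ =>
    rw [shuffle_cons_cons, List.mem_append, List.mem_map, List.mem_map] at hz
    rcases hz with ⟨y, hy, rfl⟩ | ⟨y, hy, rfl⟩
    · rw [List.length_cons, ih₁ hy, List.length_cons (a := a), Nat.add_right_comm]
    · rw [List.length_cons, ih₂ hy, List.length_cons (a := b), Nat.add_assoc]

/-- A unital function on words that is multiplicative for the shuffle product. -/
def IsShuffleCharacter (φ : List D → ℝ) : Prop :=
  φ [] = 1 ∧ ∀ u w, φ u * φ w = ((shuffle u w).map φ).sum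

theorem isShuffleCharacter_of_cons_eq_zero {φ : List D → ℝ} (hnil : φ [] = 1)
    (hcons : ∀ a w, φ (a :: w) = 0) : IsShuffleCharacter φ := by
  refine ⟨hnil, fun u w => ?_⟩
  cases u with
  | nil => simp [shuffle_nil_left, hnil]
  | cons a u =>
    cases w with
    | nil => simp [shuffle_nil_right, hnil]
    | cons b w => simp [shuffle_cons_cons, hcons, Function.comp_def]

theorem IsShuffleCharacter.pow_length_mul {φ : List D → ℝ} (hφ : IsShuffleCharacter φ) (c : ℝ) :
    IsShuffleCharacter fun w => c ^ w.length * φ w := by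
  refine ⟨by simp [hφ.1], fun u w => ?_⟩
  rw [mul_mul_mul_comm, ← pow_add, hφ.2 u w, ← List.sum_map_mul_left]
  exact congrArg List.sum (List.map_congr_left fun z hz => by rw [length_of_mem_shuffle hz])

/-- The convolution of the exponential of the letter evaluation `t χ` with a function `φ` on words,
the value on words of `exp (t v) ⊗ s` if `χ` and `φ` are the values of the letters at `v` and of the
words at `s`. -/
noncomputable def expConv (χ : D → ℝ) (φ : List D → ℝ) (t : ℝ) (w : List D) : ℝ :=
  ∑ i ∈ Finset.range (w.length + 1),
    t ^ i / i.factorial * ((w.take i).map χ).prod * φ (w.drop i)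

theorem expConv_nil (χ : D → ℝ) (φ : List D → ℝ) (t : ℝ) : expConv χ φ t [] = φ [] := by
  simp [expConv]

theorem expConv_cons (χ : D → ℝ) (φ : List D → ℝ) (t : ℝ) (a : D) (w : List D) :
    expConv χ φ t (a :: w) = (∑ i ∈ Finset.range (w.length + 1), t ^ (i + 1) / (i + 1).factorial *
      (χ a * ((w.take i).map χ).prod) * φ (w.drop i)) + φ (a :: w) := by
  rw [expConv, List.length_cons, Finset.sum_range_succ']
  simp

theorem expConv_zero (χ : D → ℝ) (φ : List D → ℝ) : expConv χ φ 0 = φ := by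
  funext w
  cases w with
  | nil => exact expConv_nil χ φ 0
  | cons a w => simp [expConv_cons]

theorem hasDerivAt_expConv_cons (χ : D → ℝ) (φ : List D → ℝ) (a : D) (w : List D) (t : ℝ) :
    HasDerivAt (fun t => expConv χ φ t (a :: w)) (χ a * expConv χ φ t w) t := by
  simp only [expConv_cons]
  rw [expConv, Finset.mul_sum]
  refine (HasDerivAt.fun_sum fun i _ => ?_).add_const _
  refine ((((hasDerivAt_pow (i + 1) t).div_const _).mul_const _).mul_const _).congr_deriv ?_
  rw [Nat.factorial_succ, Nat.add_sub_cancel]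
  push_cast
  field_simp

theorem hasDerivAt_list_sum {ι : Type*} (l : List ι) {f f' : ι → ℝ → ℝ} {t : ℝ}
    (h : ∀ i ∈ l, HasDerivAt (f i) (f' i t) t) :
    HasDerivAt (fun t => (l.map fun i => f i t).sum) (l.map fun i => f' i t).sum t := by
  induction l with
  | nil => exact hasDerivAt_const t 0
  | cons i l ih =>
    simp only [List.map_cons, List.sum_cons]
    exact (h i List.mem_cons_self).add (ih fun j hj => h j (List.mem_cons_of_mem i hj))

-- Both sides of the shuffle identity for `exp (t χ) * φ` have the same derivative in `t`, by the
-- identity for shorter words, and they agree at `t = 0`.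
theorem IsShuffleCharacter.expConv {φ : List D → ℝ} (hφ : IsShuffleCharacter φ) (χ : D → ℝ)
    (t : ℝ) : IsShuffleCharacter (expConv χ φ t) := by
  refine ⟨by rw [expConv_nil, hφ.1], fun u w => ?_⟩
  induction u, w using shuffle.induct generalizing t with
  | case1 w => simp [shuffle_nil_left, expConv_nil, hφ.1]
  | case2 u _ => simp [shuffle_nil_right, expConv_nil, hφ.1]
  | case3 a u b w ih₁ ih₂ =>
    have hzero := hφ.2 (a :: u) (b :: w)
    simp only [shuffle_cons_cons, List.map_append, List.sum_append, List.map_map,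
      Function.comp_def] at hzero ⊢
    set F := HRSig.expConv χ φ with hF
    have hsum (l : List (List D)) (c : D) {s : ℝ} :=
      hasDerivAt_list_sum l (f := fun z s => F s (c :: z)) (f' := fun z s => χ c * F s z)
        fun z _ => hasDerivAt_expConv_cons χ φ c z s
    have hderiv : ∀ s, HasDerivAt (fun s => F s (a :: u) * F s (b :: w) -
        (((shuffle u (b :: w)).map fun z => F s (a :: z)).sum +
          ((shuffle (a :: u) w).map fun z => F s (b :: z)).sum)) 0 s := fun s => by
      refine (((hasDerivAt_expConv_cons χ φ a u s).mul (hasDerivAt_expConv_cons χ φ b w s)).sub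
        ((hsum (shuffle u (b :: w)) a).add (hsum (shuffle (a :: u) w) b))).congr_deriv ?_
      rw [List.sum_map_mul_left, List.sum_map_mul_left, ← ih₁ s, ← ih₂ s]
      ring
    have hconst := is_const_of_deriv_eq_zero (fun s => (hderiv s).differentiableAt)
      (fun s => (hderiv s).deriv) t 0
    simpa [hF, expConv_zero, hzero, sub_eq_zero] using hconst

end Shuffle

section Coordinates

variable {E : Type u} [NormedAddCommGroup E] [NormedSpace ℝ E]

/-- The functional `f₀ ⊗ ⋯ ⊗ fₘ₋₁` on the `m`-th tensor power. The sequence `f` is infinite so that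
the functional on a product of tensors needs no casts of index sets. -/
noncomputable def coordLin (f : ℕ → E →L[ℝ] ℝ) (m : ℕ) : (⨂[ℝ]^m E) →ₗ[ℝ] ℝ :=
  PiTensorProduct.lift ((MultilinearMap.mkPiAlgebra ℝ (Fin m) ℝ).compLinearMap
    (fun i => (f i).toLinearMap))

theorem coordLin_tprod (f : ℕ → E →L[ℝ] ℝ) (m : ℕ) (v : Fin m → E) :
    coordLin f m (PiTensorProduct.tprod ℝ v) = ∏ i : Fin m, f i (v i) := by
  simp [coordLin]

theorem coordLin_cast (f : ℕ → E →L[ℝ] ℝ) {i j : ℕ} (h : i = j) (a : ⨂[ℝ]^i E) :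
    coordLin f j (TensorPower.cast ℝ E h a) = coordLin f i a := by
  subst h
  simp [TensorPower.cast_refl]

theorem coordLin_mul (f : ℕ → E →L[ℝ] ℝ) {i j : ℕ} (a : ⨂[ℝ]^i E) (b : ⨂[ℝ]^j E) :
    coordLin f (i + j) (GradedMonoid.GMul.mul (A := fun i => ⨂[ℝ]^i E) a b) =
      coordLin f i a * coordLin (fun k => f (i + k)) j b := by
  let B : (⨂[ℝ]^i E) →ₗ[ℝ] (⨂[ℝ]^j E) →ₗ[ℝ] (⨂[ℝ]^(i + j) E) :=
    (TensorProduct.mk ℝ (⨂[ℝ]^i E) (⨂[ℝ]^j E)).compr₂ TensorPower.mulEquiv.toLinearMap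
  have hB : B.compr₂ (coordLin f (i + j)) =
      (LinearMap.mul ℝ ℝ).compl₁₂ (coordLin f i) (coordLin (fun k => f (i + k)) j) := by
    refine PiTensorProduct.ext (MultilinearMap.ext fun v => ?_)
    refine PiTensorProduct.ext (MultilinearMap.ext fun w => ?_)
    change coordLin f (i + j) (GradedMonoid.GMul.mul (A := fun i => ⨂[ℝ]^i E)
      (PiTensorProduct.tprod ℝ v) (PiTensorProduct.tprod ℝ w)) =
      coordLin f i (PiTensorProduct.tprod ℝ v) *
        coordLin (fun k => f (i + k)) j (PiTensorProduct.tprod ℝ w)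
    simp only [TensorPower.tprod_mul_tprod, coordLin_tprod, Fin.prod_univ_add, Fin.append_left,
      Fin.append_right, Fin.val_castAdd, Fin.val_natAdd]
  exact LinearMap.congr_fun₂ hB a b

theorem coordLin_texp (f : ℕ → E →L[ℝ] ℝ) (v : E) (m : ℕ) :
    coordLin f m (texp v m) = 1 ^ m / m.factorial * ∏ k ∈ Finset.range m, f k v := by
  rw [texp, map_smul, coordLin_tprod, Finset.prod_range, smul_eq_mul, one_pow, one_div]

/-- The coordinate `⟨w, s⟩` of a tensor series that belongs to a word of functionals. -/
noncomputable def wordCoord (s : ∀ m : ℕ, ⨂[ℝ]^m E) (w : List (E →L[ℝ] ℝ)) : ℝ :=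
  coordLin (fun k => w.getD k 0) w.length (s w.length)

theorem wordCoord_tone_nil : wordCoord (tone (E := E)) [] = 1 :=
  (coordLin_tprod _ 0 _).trans (Fin.prod_univ_zero _)

theorem wordCoord_tone_cons (f : E →L[ℝ] ℝ) (w : List (E →L[ℝ] ℝ)) :
    wordCoord (tone (E := E)) (f :: w) = 0 :=
  map_zero (coordLin _ _)

theorem prod_range_getD_eq_prod_take {D M : Type*} [CommMonoid M] (g : D → M) (d : D)
    {w : List D} {i : ℕ} (hi : i ≤ w.length) :
    ∏ k ∈ Finset.range i, g (w.getD k d) = ((w.take i).map g).prod := by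
  induction w generalizing i with
  | nil => simp [Nat.le_zero.mp hi]
  | cons a w ih =>
    cases i with
    | zero => simp
    | succ i =>
      simp only [Finset.prod_range_succ', List.getD_cons_succ, List.getD_cons_zero,
        List.take_succ_cons, List.map_cons, List.prod_cons, ih (Nat.succ_le_succ_iff.mp hi),
        mul_comm]

theorem wordCoord_tconv_texp (v : E) (s : ∀ m : ℕ, ⨂[ℝ]^m E) :
    wordCoord (tconv (texp v) s) = expConv (fun f => f v) (wordCoord s) 1 := by
  funext w
  rw [wordCoord, tconv, map_sum, expConv, Finset.sum_range]
  refine Finset.sum_congr rfl fun i _ => ?_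
  have hdrop : coordLin (fun k => w.getD (i + k) 0) (w.length - i) (s (w.length - i)) =
      wordCoord s (w.drop i) := by
    rw [wordCoord, ← List.length_drop]
    simp only [List.getD_eq_getElem?_getD, List.getElem?_drop]
  rw [coordLin_cast, coordLin_mul, coordLin_texp, hdrop,
    prod_range_getD_eq_prod_take (fun f : E →L[ℝ] ℝ => f v) 0 (Nat.lt_succ_iff.mp i.2)]

theorem wordCoord_expProd_cons (v : E) (l : List E) :
    wordCoord (expProd (v :: l)) = expConv (fun f => f v) (wordCoord (expProd l)) 1 :=
  wordCoord_tconv_texp v _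

theorem isShuffleCharacter_wordCoord_expProd (l : List E) :
    IsShuffleCharacter (wordCoord (expProd l)) := by
  induction l with
  | nil => exact isShuffleCharacter_of_cons_eq_zero wordCoord_tone_nil wordCoord_tone_cons
  | cons v l ih =>
    rw [wordCoord_expProd_cons]
    exact ih.expConv _ 1

end Coordinates

section Steps

variable {S K : Type*} [Field K] (ℓ : S → K)

open Polynomial

/-- The functional `p ↦ ∑ⱼ ℓ(vⱼ) (p(Nⱼ + 1) - p(Nⱼ))` on polynomials, with `Nⱼ` the number of
vectors after `vⱼ` in the list `[v₁, …, vₙ]`. -/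
noncomputable def stepSum : List S → K[X] →ₗ[K] K
  | [] => 0
  | v :: l => stepSum l + ℓ v • (leval ((l.length : K) + 1) - leval (l.length : K))

theorem stepSum_cons_apply (v : S) (l : List S) (p : K[X]) :
    stepSum ℓ (v :: l) p =
      stepSum ℓ l p + ℓ v * (p.eval ((l.length : K) + 1) - p.eval (l.length : K)) := rfl

theorem stepSum_eq_zero {l : List S} {p : K[X]}
    (h : ∀ k : ℕ, k ≤ l.length → p.eval (k : K) = 0) : stepSum ℓ l p = 0 := by
  induction l with
  | nil => rfl
  | cons v l ih =>
    have hsucc := h (l.length + 1) le_rfl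
    push_cast at hsucc
    rw [stepSum_cons_apply, ih fun k hk => h k (Nat.le_succ_of_le hk), hsucc,
      h l.length (Nat.le_succ _), sub_zero, mul_zero, zero_add]

theorem map_eq_of_stepSum_eq [CharZero K] {l l' : List S} (hlen : l.length = l'.length)
    (h : stepSum ℓ l = stepSum ℓ l') : l.map ℓ = l'.map ℓ := by
  induction l generalizing l' with
  | nil => rw [List.length_eq_zero_iff.mp hlen.symm]
  | cons v l ih =>
    obtain _ | ⟨v', l'⟩ := l'
    · simp at hlen
    rw [List.length_cons, List.length_cons, add_left_inj] at hlen
    -- A polynomial that vanishes at all nodes but the last one isolates the first step.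
    have hv : ℓ v = ℓ v' := by
      set p : K[X] := Lagrange.nodal (Finset.range (l.length + 1)) fun k : ℕ => (k : K)
      have hp : ∀ k : ℕ, k ≤ l.length → p.eval (k : K) = 0 := fun k hk =>
        Lagrange.eval_nodal_at_node (v := fun k : ℕ => (k : K)) (Finset.mem_range_succ_iff.mpr hk)
      have hlast : p.eval ((l.length : K) + 1) ≠ 0 :=
        Lagrange.eval_nodal_not_at_node fun k hk => by
          exact_mod_cast (Finset.mem_range.mp hk).ne'
      have hstep := LinearMap.congr_fun h p
      rw [stepSum_cons_apply, stepSum_cons_apply, stepSum_eq_zero ℓ hp,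
        stepSum_eq_zero ℓ (hlen ▸ hp), ← hlen, hp _ le_rfl, sub_zero, zero_add, zero_add] at hstep
      exact mul_right_cancel₀ hlast hstep
    rw [stepSum, stepSum, hv, hlen, add_left_inj] at h
    rw [List.map_cons, List.map_cons, hv, ih hlen h]

theorem stepSum_one (l : List S) : stepSum ℓ l 1 = 0 := by
  induction l with
  | nil => rfl
  | cons v l ih => simp [stepSum_cons_apply, ih]

theorem stepSum_eq_of_forall_pow {l l' : List S}
    (h : ∀ b : ℕ, stepSum ℓ l (X ^ (b + 1)) = stepSum ℓ l' (X ^ (b + 1))) :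
    stepSum ℓ l = stepSum ℓ l' := by
  refine lhom_ext' fun n => LinearMap.ext_ring ?_
  rw [LinearMap.comp_apply, LinearMap.comp_apply, monomial_one_right_eq_X_pow]
  cases n with
  | zero => rw [pow_zero, stepSum_one, stepSum_one]
  | succ b => exact h b

end Steps

section Separation

variable {E : Type u} [NormedAddCommGroup E] [NormedSpace ℝ E] {e : E →L[ℝ] ℝ}

theorem wordCoord_expProd_replicate {l : List E} (hl : ∀ v ∈ l, e v = 1) (b : ℕ) :
    wordCoord (expProd l) (List.replicate b e) = (l.length : ℝ) ^ b / b.factorial := by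
  induction l generalizing b with
  | nil =>
    cases b with
    | zero => exact wordCoord_tone_nil.trans (by simp)
    | succ b => exact (wordCoord_tone_cons e (List.replicate b e)).trans (by simp)
  | cons v l ih =>
    rw [List.forall_mem_cons] at hl
    rw [wordCoord_expProd_cons, expConv, List.length_replicate, List.length_cons, Nat.cast_succ,
      add_comm (l.length : ℝ), add_pow_div_factorial]
    refine Finset.sum_congr rfl fun i _ => ?_
    simp [List.take_replicate, List.drop_replicate, hl.1, ih hl.2]

theorem wordCoord_expProd_cons_replicate (f : E →L[ℝ] ℝ) {l : List E} (hl : ∀ v ∈ l, e v = 1)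
    (b : ℕ) : wordCoord (expProd l) (f :: List.replicate b e) =
      stepSum f l (Polynomial.X ^ (b + 1)) / (b + 1).factorial := by
  induction l with
  | nil => exact (wordCoord_tone_cons f (List.replicate b e)).trans (by simp [stepSum])
  | cons v l ih =>
    rw [List.forall_mem_cons] at hl
    have hpow := add_pow_div_factorial 1 (l.length : ℝ) (b + 1)
    rw [Finset.sum_range_succ', pow_zero, Nat.sub_zero, Nat.factorial_zero, Nat.cast_one, div_one,
      one_mul, ← sub_eq_iff_eq_add, ← sub_div, add_comm 1] at hpow
    rw [wordCoord_expProd_cons, expConv_cons, ih hl.2, List.length_replicate, stepSum_cons_apply,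
      add_comm, add_div, mul_div_assoc, Polynomial.eval_pow, Polynomial.eval_pow,
      Polynomial.eval_X, Polynomial.eval_X, hpow, Finset.mul_sum]
    refine congrArg _ (Finset.sum_congr rfl fun i _ => ?_)
    simp only [one_pow, one_div, List.take_replicate, List.map_replicate, hl.1, List.prod_replicate,
      mul_one, List.drop_replicate, wordCoord_expProd_replicate hl.2, Nat.reduceSubDiff]
    ring

theorem eq_of_wordCoord_expProd_eq {l l' : List E} (hl : ∀ v ∈ l, e v = 1)
    (hl' : ∀ v ∈ l', e v = 1) (hlen : l.length = l'.length)
    (h : wordCoord (expProd l) = wordCoord (expProd l')) : l = l' := by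
  have hmap (f : E →L[ℝ] ℝ) : l.map f = l'.map f := by
    refine map_eq_of_stepSum_eq f hlen (stepSum_eq_of_forall_pow f fun b => ?_)
    have hb := congrFun h (f :: List.replicate b e)
    rwa [wordCoord_expProd_cons_replicate f hl, wordCoord_expProd_cons_replicate f hl',
      div_left_inj' (Nat.cast_ne_zero.mpr (Nat.factorial_ne_zero _))] at hb
  refine List.ext_getElem hlen fun i hi hi' => ?_
  by_contra hne
  obtain ⟨f, hf⟩ := SeparatingDual.exists_separating_of_ne (R := ℝ) hne
  have hget := congrArg (fun m : List ℝ => m[i]?) (hmap f)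
  exact hf (by simpa [hi, hi'] using hget)

end Separation

section Functionals

variable (α : AdmissibleNorm.{u}) {E : Type u} [NormedAddCommGroup E] [NormedSpace ℝ E]

/-- The extension of `f₀ ⊗ ⋯ ⊗ fₘ₋₁` to the completed tensor power. -/
noncomputable def coordCLM (f : ℕ → E →L[ℝ] ℝ) (m : ℕ) :
    UniformSpace.Completion (TPow α E m) →L[ℝ] ℝ :=
  (((coordLin f m).comp (toTPow α m).symm.toLinearMap).mkContinuous (∏ i : Fin m, ‖f i‖)
    fun a => α.dual_le E m (fun i => f i) ((toTPow α m).symm a)).extend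
      UniformSpace.Completion.toComplL

theorem coordCLM_toCompletion (f : ℕ → E →L[ℝ] ℝ) (m : ℕ) (a : ⨂[ℝ]^m E) :
    coordCLM α f m (toCompletion α E m a) = coordLin f m a :=
  ContinuousLinearMap.extend_eq _ UniformSpace.Completion.denseRange_coe
    (UniformSpace.Completion.isUniformInducing_coe _) (toTPow α m a)

/-- The coordinate functional of a word on the completed tensor algebra. -/
noncomputable def wordCLM (w : List (TimeExt E →L[ℝ] ℝ)) : TA α E →L[ℝ] ℝ :=
  (coordCLM α (fun k => w.getD k 0) w.length).comp
    (lp.evalCLM ℝ (fun m : ℕ => UniformSpace.Completion (TPow α (TimeExt E) m)) 1 w.length)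

theorem wordCLM_sig {T : ℕ} (x : Fin (T + 1) → E) (w : List (TimeExt E →L[ℝ] ℝ)) :
    wordCLM α w (sig α x) = wordCoord (expProd (List.ofFn (incr x))) w :=
  coordCLM_toCompletion α _ _ _

end Functionals

section SignedIntegralGenerates

variable {X : Type u} [mX : MeasurableSpace X] {F : Type v} [NormedAddCommGroup F]
  [NormedSpace ℝ F] [CompleteSpace F] [TopologicalSpace.SeparableSpace F] {f : X → F} {C : ℝ}

theorem signedMeasurableSpace_eq_comap_signedIntegral (hf : StronglyMeasurable f)
    (hC : ∀ x, ‖f x‖ ≤ C) {𝒜 : Subalgebra ℝ (X → ℝ)}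
    (h𝒜 : ∀ a ∈ 𝒜, ∃ l : F →L[ℝ] ℝ, a = fun x => l (f x))
    (hX : mX ≤ ⨆ a : 𝒜, (borel ℝ).comap (a : X → ℝ)) :
    signedMeasurableSpace X = (borel F).comap fun μ => signedIntegral μ f := by
  borelize F
  have : SecondCountableTopology F := UniformSpace.secondCountable_of_separable F
  refine le_antisymm ?_ (measurable_signedIntegral hf hC).comap_le
  refine signedMeasurableSpace_le_of_measurable_signedIntegral (𝒜 := 𝒜)
    (hX.antisymm (iSup_le fun ⟨a, ha⟩ => ?_)) (fun a ha => ?_) fun a ha => ?_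
  all_goals obtain ⟨l, rfl⟩ := h𝒜 a ha
  · rw [← BorelSpace.measurable_eq (α := ℝ)]
    exact (l.continuous.comp_stronglyMeasurable hf).measurable.comap_le
  · exact ⟨‖l‖ * C, fun x => l.le_opNorm_of_le (hC x)⟩
  · simp only [signedIntegral_clm_comp l _ hf hC]
    exact l.continuous.measurable.comp (comap_measurable _)

end SignedIntegralGenerates

section ShuffleAlgebra

variable {X D : Type*}

theorem wordFunction_mul {φ : X → List D → ℝ} (hφ : ∀ x, IsShuffleCharacter (φ x))
    (u w : List D) :
    (fun x => φ x u) * (fun x => φ x w) = ((shuffle u w).map fun z x => φ x z).sum := by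
  funext x
  rw [Pi.mul_apply, (hφ x).2, Pi.list_sum_apply, List.map_map]
  rfl

/-- The algebra of functions spanned by the values of a family of shuffle characters at words. -/
noncomputable def shuffleAlgebra (φ : X → List D → ℝ) (hφ : ∀ x, IsShuffleCharacter (φ x)) :
    Subalgebra ℝ (X → ℝ) :=
  (Submodule.span ℝ (Set.range fun w x => φ x w)).toSubalgebra
    (Submodule.subset_span ⟨[], funext fun x => (hφ x).1⟩) fun a b ha hb => by
      have hmul := Submodule.mul_mem_mul ha hb
      rw [Submodule.span_mul_span] at hmul
      refine Submodule.span_le.mpr ?_ hmul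
      rintro _ ⟨_, ⟨u, rfl⟩, _, ⟨w, rfl⟩, rfl⟩
      simp only [SetLike.mem_coe, wordFunction_mul hφ]
      refine list_sum_mem fun y hy => ?_
      obtain ⟨z, -, rfl⟩ := List.mem_map.mp hy
      exact Submodule.subset_span ⟨z, rfl⟩

theorem mem_shuffleAlgebra {φ : X → List D → ℝ} (hφ : ∀ x, IsShuffleCharacter (φ x))
    (w : List D) : (fun x => φ x w) ∈ shuffleAlgebra φ hφ :=
  Submodule.subset_span ⟨w, rfl⟩

theorem exists_clm_of_mem_shuffleAlgebra {F : Type*} [NormedAddCommGroup F] [NormedSpace ℝ F]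
    {f : X → F} {ψ : List D → F →L[ℝ] ℝ} (hψ : ∀ x, IsShuffleCharacter fun w => ψ w (f x))
    {a : X → ℝ} (ha : a ∈ shuffleAlgebra (fun x w => ψ w (f x)) hψ) :
    ∃ l : F →L[ℝ] ℝ, a = fun x => l (f x) := by
  have hle : Submodule.span ℝ (Set.range fun w x => ψ w (f x)) ≤
      LinearMap.range (LinearMap.pi fun x => (ContinuousLinearMap.apply ℝ ℝ (f x)).toLinearMap) :=
    Submodule.span_le.mpr (Set.range_subset_iff.mpr fun w => ⟨ψ w, rfl⟩)
  obtain ⟨l, rfl⟩ := hle ha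
  exact ⟨l, rfl⟩

end ShuffleAlgebra

section Increments

variable {E : Type*} [NormedAddCommGroup E] {n : ℕ}

theorem fst_incr [NormedSpace ℝ E] (x : Fin (n + 1) → E) (t : Fin (n + 1)) :
    WithLp.fstL 1 ℝ ℝ E (incr x t) = 1 := by
  refine Fin.cases ?_ (fun t => ?_) t <;> rfl

theorem incr_injective : Function.Injective fun x : Fin (n + 1) → E => incr x := by
  intro x y h
  have hsnd (t) : (incr x t).snd = (incr y t).snd := congrArg WithLp.snd (congrFun h t)
  funext t
  induction t using Fin.induction with
  | zero => exact hsnd 0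
  | succ t ih =>
    have hstep : x t.succ - x t.castSucc = y t.succ - y t.castSucc := hsnd t.succ
    rwa [ih, sub_left_inj] at hstep

end Increments

section NormalizedSignature

variable {α : AdmissibleNorm.{u}} {E : Type u} [NormedAddCommGroup E] [NormedSpace ℝ E]
variable {Λ : TA α E → TA α E}

theorem IsTensorNormalization.continuous_comp_sig (hΛ : IsTensorNormalization α Λ) {n : ℕ} :
    Continuous fun x : Fin (n + 1) → E => Λ (sig α x) :=
  hΛ.2.2.1.comp_continuous (continuous_sig α) (sig_mem_unitLevel α)

theorem IsTensorNormalization.exists_norm_comp_sig_le (hΛ : IsTensorNormalization α Λ) :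
    ∃ K : ℝ, ∀ (n : ℕ) (x : Fin (n + 1) → E), ‖Λ (sig α x)‖ ≤ K :=
  hΛ.2.1.imp fun _ hK _ x => hK _ (sig_mem_unitLevel α x)

theorem IsTensorNormalization.exists_wordCLM_eq (hΛ : IsTensorNormalization α Λ) {n : ℕ}
    (x : Fin (n + 1) → E) : ∃ c : ℝ, 0 < c ∧
      ∀ w, wordCLM α w (Λ (sig α x)) =
        c ^ w.length * wordCoord (expProd (List.ofFn (incr x))) w := by
  obtain ⟨lam, hlam⟩ := hΛ.1
  obtain ⟨hpos, happly⟩ := hlam _ (sig_mem_unitLevel α x)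
  refine ⟨lam (sig α x), hpos, fun w => ?_⟩
  rw [← wordCLM_sig α]
  change coordCLM α _ _ (Λ (sig α x) w.length) = _ * coordCLM α _ _ (sig α x w.length)
  rw [happly, map_smul, smul_eq_mul]

theorem IsTensorNormalization.isShuffleCharacter_wordCLM (hΛ : IsTensorNormalization α Λ) {n : ℕ}
    (x : Fin (n + 1) → E) : IsShuffleCharacter fun w => wordCLM α w (Λ (sig α x)) := by
  obtain ⟨c, -, hc⟩ := hΛ.exists_wordCLM_eq x
  simpa only [hc] using (isShuffleCharacter_wordCoord_expProd _).pow_length_mul c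

-- The word of the time functional recovers the dilation factor, which then can be cancelled.
theorem IsTensorNormalization.eq_of_forall_wordCLM_eq (hΛ : IsTensorNormalization α Λ) {n : ℕ}
    {x y : Fin (n + 1) → E}
    (h : ∀ w, wordCLM α w (Λ (sig α x)) = wordCLM α w (Λ (sig α y))) : x = y := by
  have htime (z : Fin (n + 1) → E) : ∀ v ∈ List.ofFn (incr z), WithLp.fstL 1 ℝ ℝ E v = 1 :=
    List.forall_mem_ofFn_iff.mpr (fst_incr z)
  obtain ⟨c, hc, hcx⟩ := hΛ.exists_wordCLM_eq x
  obtain ⟨d, -, hdy⟩ := hΛ.exists_wordCLM_eq y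
  simp only [hcx, hdy] at h
  obtain rfl : c = d := by
    have hword := h (List.replicate 1 (WithLp.fstL 1 ℝ ℝ E))
    rw [wordCoord_expProd_replicate (htime x), wordCoord_expProd_replicate (htime y)] at hword
    simpa [Nat.cast_add_one_ne_zero] using hword
  refine incr_injective (List.ofFn_injective (eq_of_wordCoord_expProd_eq (htime x) (htime y)
    (by simp only [List.length_ofFn]) (funext fun w => ?_)))
  exact mul_left_cancel₀ (pow_pos hc _).ne' (h w)

theorem IsTensorNormalization.injective_comp_sig (hΛ : IsTensorNormalization α Λ) {n : ℕ} :
    Function.Injective fun x : Fin (n + 1) → E => Λ (sig α x) := fun _ _ h =>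
  hΛ.eq_of_forall_wordCLM_eq fun w => congrArg (wordCLM α w) h

variable [TopologicalSpace.SeparableSpace E] {n : ℕ}
variable {X : Type u} [mX : MeasurableSpace X] {g : X → Fin (n + 1) → E}

theorem IsTensorNormalization.stronglyMeasurable_comp_sig (hΛ : IsTensorNormalization α Λ)
    (hX : mX = (borel (Fin (n + 1) → E)).comap g) :
    StronglyMeasurable fun x => Λ (sig α (g x)) := by
  have : SecondCountableTopology (TA α E) := UniformSpace.secondCountable_of_separable _
  borelize (Fin (n + 1) → E)
  rw [hX]
  exact hΛ.continuous_comp_sig.stronglyMeasurable.comp_measurable (comap_measurable _)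

variable [CompleteSpace E]

theorem IsTensorNormalization.borel_eq_iSup_comap_wordCLM (hΛ : IsTensorNormalization α Λ) :
    borel (Fin (n + 1) → E) = ⨆ w, (borel ℝ).comap fun x => wordCLM α w (Λ (sig α x)) := by
  have : SecondCountableTopology E := UniformSpace.secondCountable_of_separable E
  exact borel_eq_iSup_comap_of_separating
    (fun w => (wordCLM α w).continuous.comp hΛ.continuous_comp_sig)
    fun _ _ => hΛ.eq_of_forall_wordCLM_eq

theorem IsTensorNormalization.signedMeasurableSpace_eq_comap (hΛ : IsTensorNormalization α Λ)
    (hX : mX = (borel (Fin (n + 1) → E)).comap g) :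
    signedMeasurableSpace X =
      (borel (TA α E)).comap fun μ => signedIntegral μ fun x => Λ (sig α (g x)) := by
  obtain ⟨K, hK⟩ := hΛ.exists_norm_comp_sig_le
  have hchar (x : X) := hΛ.isShuffleCharacter_wordCLM (g x)
  refine signedMeasurableSpace_eq_comap_signedIntegral (hΛ.stronglyMeasurable_comp_sig hX)
    (fun x => hK n (g x)) (fun a => exists_clm_of_mem_shuffleAlgebra hchar) ?_
  rw [hX, hΛ.borel_eq_iSup_comap_wordCLM, MeasurableSpace.comap_iSup]
  refine iSup_le fun w => ?_
  rw [MeasurableSpace.comap_comp]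
  exact le_iSup_of_le ⟨_, mem_shuffleAlgebra hchar w⟩ le_rfl

theorem IsTensorNormalization.injective_integral (hΛ : IsTensorNormalization α Λ)
    (hX : mX = (borel (Fin (n + 1) → E)).comap g) :
    Function.Injective fun P : ProbabilityMeasure X => ∫ x, Λ (sig α (g x)) ∂(P : Measure X) := by
  intro P Q hPQ
  have hsigned : (P : Measure X).toSignedMeasure = (Q : Measure X).toSignedMeasure :=
    injective_of_eq_comap (hΛ.signedMeasurableSpace_eq_comap hX)
      (by simpa only [signedIntegral_toSignedMeasure] using hPQ)
  have hmeasure : (P : Measure X) = (Q : Measure X) :=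
    Measure.toSignedMeasure_eq_toSignedMeasure_iff.mp hsigned
  exact Subtype.ext hmeasure

theorem IsTensorNormalization.borel_probabilityMeasure_eq_comap [TopologicalSpace X]
    [OpensMeasurableSpace X] [HasOuterApproxClosed X] [SecondCountableTopology X]
    (hΛ : IsTensorNormalization α Λ) (hg : Continuous g)
    (hX : mX = (borel (Fin (n + 1) → E)).comap g) :
    borel (ProbabilityMeasure X) =
      (borel (TA α E)).comap fun P : ProbabilityMeasure X =>
        ∫ x, Λ (sig α (g x)) ∂(P : Measure X) := by
  obtain ⟨K, hK⟩ := hΛ.exists_norm_comp_sig_le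
  refine le_antisymm (borel_probabilityMeasure_le_comap_toSignedMeasure.trans_eq ?_)
    (continuous_integral_of_bounded (hΛ.continuous_comp_sig.comp hg)
      fun x => hK n (g x)).borel_measurable.comap_le
  rw [hΛ.signedMeasurableSpace_eq_comap hX, MeasurableSpace.comap_comp]
  simp only [Function.comp_def, signedIntegral_toSignedMeasure]

end NormalizedSignature

section Towers

variable (α : AdmissibleNorm.{u}) (V : Type u) [NormedAddCommGroup V] [NormedSpace ℝ V]

instance completeSpace_Ta [h : CompleteSpace V] : ∀ r, CompleteSpace (Ta α V r)
  | 0 => h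
  | r + 1 => inferInstanceAs (CompleteSpace (TA α (Ta α V r)))

instance separableSpace_Ta [h : TopologicalSpace.SeparableSpace V] :
    ∀ r, TopologicalSpace.SeparableSpace (Ta α V r)
  | 0 => h
  | r + 1 =>
    have := separableSpace_Ta (h := h) r
    inferInstanceAs (TopologicalSpace.SeparableSpace (TA α (Ta α V r)))

instance secondCountableTopology_Ta [TopologicalSpace.SeparableSpace V] (r : ℕ) :
    SecondCountableTopology (Ta α V r) :=
  UniformSpace.secondCountable_of_separable _

theorem secondCountableTopology_and_pseudoMetrizableSpace_probSp (T : ℕ → ℕ) (X : Type u)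
    [TopologicalSpace X] [hX : SecondCountableTopology X]
    [hX' : TopologicalSpace.PseudoMetrizableSpace X] (r : ℕ) :
    SecondCountableTopology (ProbSp T X r) ∧
      TopologicalSpace.PseudoMetrizableSpace (ProbSp T X r) := by
  induction r with
  | zero => exact ⟨hX, hX'⟩
  | succ r ih =>
    obtain ⟨_, _⟩ := ih
    borelize (Fin (T r + 1) → ProbSp T X r)
    exact ⟨inferInstanceAs
        (SecondCountableTopology (ProbabilityMeasure (Fin (T r + 1) → ProbSp T X r))),
      inferInstanceAs (TopologicalSpace.PseudoMetrizableSpace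
        (ProbabilityMeasure (Fin (T r + 1) → ProbSp T X r)))⟩

end Towers

section Robust

variable {α : AdmissibleNorm.{u}} {V : Type u} [NormedAddCommGroup V] [NormedSpace ℝ V]
variable {T : ℕ → ℕ} {Λ : ∀ r, TA α (Ta α V r) → TA α (Ta α V r)} {r : ℕ}

theorem exists_norm_liftSig_le (hΛ : IsTensorNormalization α (Λ r)) :
    ∃ K : ℝ, ∀ {X : Type u} {n : ℕ} (g : X → Ta α V r) (x : Fin (n + 1) → X),
      ‖liftSig Λ g x‖ ≤ K :=
  hΛ.exists_norm_comp_sig_le.imp fun _ hK _ _ _ _ => hK _ _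

theorem continuous_liftSig (hΛ : IsTensorNormalization α (Λ r)) {n : ℕ} {X : Type u}
    [TopologicalSpace X] {g : X → Ta α V r} (hg : Continuous g) :
    Continuous fun x : Fin (n + 1) → X => liftSig Λ g x :=
  hΛ.continuous_comp_sig.comp (by fun_prop)

variable (hΛ : ∀ r, IsTensorNormalization α (Λ r))
include hΛ

theorem continuous_robustSig : ∀ r, Continuous (robustSig Λ T r)
  | 0 => continuous_id
  | r + 1 => continuous_liftSig (hΛ r) (continuous_robustSig r)

theorem injective_robustSig : ∀ r, Function.Injective (robustSig Λ T r)
  | 0 => Function.injective_id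
  | r + 1 => (hΛ r).injective_comp_sig.comp (injective_robustSig r).comp_left

theorem exists_norm_robustESig_le (r : ℕ) :
    ∃ C : ℝ, ∀ μ : ProbSp T V (r + 1), ‖robustESig Λ T (r + 1) μ‖ ≤ C := by
  obtain ⟨K, hK⟩ := exists_norm_liftSig_le (hΛ r)
  refine ⟨K, fun μ => ?_⟩
  borelize (Fin (T r + 1) → ProbSp T V r)
  have : IsProbabilityMeasure (BorelProb.toMeasure μ) := Subtype.prop μ
  simpa using! norm_integral_le_of_norm_le_const (μ := BorelProb.toMeasure μ)
    (Eventually.of_forall (hK (robustESig Λ T r)))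

variable [TopologicalSpace.SeparableSpace V]

theorem continuous_robustESig (r : ℕ) : Continuous (robustESig Λ T r) := by
  induction r with
  | zero => exact continuous_id
  | succ r ih =>
    borelize (Fin (T r + 1) → ProbSp T V r)
    obtain ⟨K, hK⟩ := exists_norm_liftSig_le (hΛ r)
    have : CompleteSpace (Ta α V (r + 1)) := inferInstanceAs (CompleteSpace (TA α (Ta α V r)))
    exact continuous_integral_of_bounded (continuous_liftSig (hΛ r) ih) (hK _)

theorem integrable_liftSig_robustESig (r : ℕ) (μ : BorelProb (Fin (T r + 1) → ProbSp T V r)) :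
    @Integrable _ _ _ _ (borel _) (liftSig Λ (robustESig Λ T r)) μ.toMeasure := by
  borelize (Fin (T r + 1) → ProbSp T V r)
  have : IsProbabilityMeasure μ.toMeasure := Subtype.prop μ
  obtain ⟨K, hK⟩ := exists_norm_liftSig_le (hΛ r)
  have hcont := continuous_liftSig (n := T r) (hΛ r) (continuous_robustESig (T := T) hΛ r)
  exact .of_bound hcont.aestronglyMeasurable K (Eventually.of_forall (hK _))

variable [CompleteSpace V]

theorem borel_probSp_eq_comap (r : ℕ) :
    borel (ProbSp T V r) = (borel (Ta α V r)).comap (robustESig Λ T r) := by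
  have : SecondCountableTopology V := secondCountableTopology_Ta α V 0
  induction r with
  | zero => exact MeasurableSpace.comap_id.symm
  | succ r ih =>
    obtain ⟨_, _⟩ := secondCountableTopology_and_pseudoMetrizableSpace_probSp T V r
    borelize (Fin (T r + 1) → ProbSp T V r)
    exact (hΛ r).borel_probabilityMeasure_eq_comap
      (continuous_pi fun t => (continuous_robustESig hΛ r).comp (continuous_apply t))
      (borel_pi_eq_comap ih)

theorem injective_robustESig : ∀ r, Function.Injective (robustESig Λ T r)
  | 0 => Function.injective_id
  | r + 1 => by
    have : SecondCountableTopology V := secondCountableTopology_Ta α V 0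
    obtain ⟨_, _⟩ := secondCountableTopology_and_pseudoMetrizableSpace_probSp T V r
    borelize (Fin (T r + 1) → ProbSp T V r)
    exact (hΛ r).injective_integral (borel_pi_eq_comap (borel_probSp_eq_comap hΛ r))

theorem measSp_eq_comap (r : ℕ) :
    (measTower T V r).str = (borel (Ta α V r)).comap (robustESigM Λ T r) := by
  induction r with
  | zero => exact MeasurableSpace.comap_id.symm
  | succ r ih => exact (hΛ r).signedMeasurableSpace_eq_comap (pi_eq_comap_borel ih)

theorem integrable_liftSig_robustESigM (r : ℕ)
    (μ : SignedMeasure (Fin (T r + 1) → MeasSp T V r)) :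
    Integrable (liftSig Λ (robustESigM Λ T r)) μ.totalVariation := by
  obtain ⟨K, hK⟩ := exists_norm_liftSig_le (hΛ r)
  have hmeas := (hΛ r).stronglyMeasurable_comp_sig
    (pi_eq_comap_borel (ι := Fin (T r + 1)) (measSp_eq_comap (T := T) hΛ r))
  exact .of_bound hmeas.aestronglyMeasurable K (Eventually.of_forall (hK _))

theorem injective_robustESigM (r : ℕ) : Function.Injective (robustESigM Λ T (r + 1)) :=
  injective_of_eq_comap (X := SignedMeasure (Fin (T r + 1) → MeasSp T V r))
    ((hΛ r).signedMeasurableSpace_eq_comap (pi_eq_comap_borel (measSp_eq_comap hΛ r)))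

end Robust

theorem exists_bounded_continuous_injective (V : Type*) [NormedAddCommGroup V] [NormedSpace ℝ V] :
    ∃ f : V → V, (∃ C : ℝ, ∀ x, ‖f x‖ ≤ C) ∧ Continuous f ∧ Function.Injective f :=
  ⟨fun x => Homeomorph.unitBall x,
    ⟨1, fun x => (mem_ball_zero_iff.mp (Homeomorph.unitBall x).2).le⟩,
    continuous_subtype_val.comp Homeomorph.unitBall.continuous,
    Subtype.val_injective.comp Homeomorph.unitBall.injective⟩

end HRSig

theorem proposition3p7 (α : AdmissibleNorm.{u}) (V : Type u) [NormedAddCommGroup V]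
    [NormedSpace ℝ V] [CompleteSpace V] [TopologicalSpace.SeparableSpace V] (T : ℕ → ℕ) :
    -- all higher rank tensor algebras are separable Banach spaces
    (∀ r : ℕ, CompleteSpace (Ta α V r) ∧ TopologicalSpace.SeparableSpace (Ta α V r)) ∧
    -- in rank zero all the spaces are `V`
    (∃ f : V → V, (∃ C : ℝ, ∀ x, ‖f x‖ ≤ C) ∧ Continuous f ∧ Function.Injective f) ∧
    -- tensor normalizations exist on all ranks
    (∃ Λ : ∀ r : ℕ, TA α (Ta α V r) → TA α (Ta α V r), ∀ r, IsTensorNormalization α (Λ r)) ∧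
    -- and for any choice of them the robust maps of all ranks have the asserted properties
    (∀ Λ : ∀ r : ℕ, TA α (Ta α V r) → TA α (Ta α V r), (∀ r, IsTensorNormalization α (Λ r)) →
      ∀ r : ℕ,
        -- the robust signature map
        ((∃ C : ℝ, ∀ x : PathSp T V (r + 1), ‖robustSig Λ T (r + 1) x‖ ≤ C) ∧
          Continuous (robustSig Λ T (r + 1)) ∧
          Function.Injective (robustSig Λ T (r + 1))) ∧
        -- the robust expected signature map on probability measures
        ((∀ μ : BorelProb (Fin (T r + 1) → ProbSp T V r),
            @MeasureTheory.Integrable _ _ _ _ (borel _) (liftSig Λ (robustESig Λ T r))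
              μ.toMeasure) ∧
          (∃ C : ℝ, ∀ μ : ProbSp T V (r + 1), ‖robustESig Λ T (r + 1) μ‖ ≤ C) ∧
          Continuous (robustESig Λ T (r + 1)) ∧
          Function.Injective (robustESig Λ T (r + 1))) ∧
        -- the robust expected signature map on signed measures
        ((∀ μ : MeasureTheory.SignedMeasure (Fin (T r + 1) → MeasSp T V r),
            MeasureTheory.Integrable (liftSig Λ (robustESigM Λ T r)) μ.totalVariation) ∧
          (∃ C : ℝ, ∀ μ : MeasureTheory.SignedMeasure (Fin (T r + 1) → MeasSp T V r),
            ‖robustESigM Λ T (r + 1) μ‖ ≤ C * μ.totalVariation.real Set.univ) ∧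
          Function.Injective (robustESigM Λ T (r + 1)))) := by
  refine ⟨fun r => ⟨completeSpace_Ta α V r, separableSpace_Ta α V r⟩,
    exists_bounded_continuous_injective V,
    ⟨fun _ => tensorNormalization, fun _ => isTensorNormalization_tensorNormalization α _⟩,
    fun Λ hΛ r => ?_⟩
  obtain ⟨K, hK⟩ := exists_norm_liftSig_le (hΛ r)
  exact ⟨⟨⟨K, hK (robustSig Λ T r)⟩, continuous_robustSig hΛ (r + 1),
      injective_robustSig hΛ (r + 1)⟩,
    ⟨integrable_liftSig_robustESig hΛ r, exists_norm_robustESig_le hΛ r,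
      continuous_robustESig hΛ (r + 1), injective_robustESig hΛ (r + 1)⟩,
    ⟨integrable_liftSig_robustESigM hΛ r,
      ⟨K, norm_signedIntegral_le (hK (robustESigM Λ T r))⟩, injective_robustESigM hΛ r⟩⟩
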